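/- (Generalized Noiseless Source Coding Theorem.) All logarithms are binary. Let $\mathcal X,\mathcal Y$ be standard Borel (e.g. Polish) spaces, let $(X,Y)\sim P_{X,Y}$ take values in $\mathcal X\times\mathcal Y$, and let $P_{Y\mid X}$ be a Markov kernel that is a version of the conditional law of $Y$ given $X$. Assume there is a constant $M$ such that for every $x\in\mathcal X$ one has $P_{Y\mid X=x}\ll P_Y$ and $\frac{dP_{Y\mid X=x}}{dP_Y}(y)\le M$ for $P_Y$-almost every $y$. For $y\in\mathcal Y$ and $\ell>0$ let $w_y(\ell)=P_X\big(\big\{x:\frac{dP_{X\mid Y=y}}{dP_X}(x)\ge \ell\big\}\big)$, and define the functional information $$I_{\mathrm F}(X;Y)=\mathbb E_{y\sim P_Y}\left[-\int_0^\infty w_y(\ell)\log w_y(\ell)\,d\ell\right].$$ For a random variable $Z$ let $H(Y\mid Z)=\mathbb E_{z\sim P_Z}\big[H(P_{Y\mid Z=z})\big]\in[0,\infty]$, where $H(P)=\mathbb E_{Y\sim P}[-\log P(\{Y\})]$ is the Shannon entropy (equal to $\infty$ if $P$ is not discrete). Let $$H^*=\inf_{Z\perp X}H(Y\mid Z),$$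 the infimum being over all random variables $Z$ with values in a standard Borel space, jointly distributed with $(X,Y)\sim P_{X,Y}$, that are independent of $X$. A relative entropy code for $P_{Y\mid X}$ consists of a random variable $Z$ (the common randomness) with values in a standard Borel space $\mathcal Z$ and independent of $X$, a measurable encoder $\mathrm{enc}:\mathcal X\times\mathcal Z\to\{0,1\}^*$ and a measurable decoder $\mathrm{dec}:\{0,1\}^*\times\mathcal Z\to\mathcal Y$ such that $\mathrm{dec}(\mathrm{enc}(x,Z),Z)\sim P_{Y\mid X=x}$ for every $x\in\mathcal X$; its rate is $H(Y\mid Z)$ with $Y=\mathrm{dec}(\mathrm{enc}(X,Z),Z)$. Let $H^*_{\mathrm{code}}$ be the infimum of the rates of all relative entropy codes. Then $$I_{\mathrm F}(X;Y)\;\le\; H^*\;\le\; H^*_{\mathrm{code}}\;\le\; I_{\mathrm F}(X;Y)+\log e .$$ In particular $I_{\mathrm F}(X;Y)\le H^*\le I_{\mathrm F}(X;Y)+\log e$, and the same holds for $H^*_{\mathrm{code}}$. -/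

import Mathlib

open MeasureTheory ProbabilityTheory
open scoped ENNReal NNReal

universe u v w

noncomputable section

/-- The surprisal `-log₂ p` of a probability `p`, in bits, with `-log₂ 0 = ∞`. -/
def surprisal (p : ℝ≥0∞) : ℝ≥0∞ :=
  if p = 0 then ∞ else ENNReal.ofReal (-Real.logb 2 p.toReal)

/-- Shannon entropy `H(P) = E_{Y ∼ P}[-log₂ P({Y})]`, in bits, of a probability measure. If `P` is
discrete this is `-∑ P({y}) log₂ P({y})`; if `P` is not discrete, the set of points of mass zero has
positive probability and the value is `∞`. -/
def entropy {𝒴 : Type v} [MeasurableSpace 𝒴] (P : Measure 𝒴) : ℝ≥0∞ :=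
  ∫⁻ y, surprisal (P {y}) ∂P

/-- Conditional entropy `H(Y | Z) = E_{z ∼ P_Z}[H(P_{Y | Z = z})]`, in bits. -/
def condEntropy {Ω : Type u} {𝒴 : Type v} {𝒵 : Type w} [MeasurableSpace Ω]
    [MeasurableSpace 𝒴] [StandardBorelSpace 𝒴] [Nonempty 𝒴] [MeasurableSpace 𝒵]
    (Y : Ω → 𝒴) (Z : Ω → 𝒵) (μ : Measure Ω) [IsFiniteMeasure μ] : ℝ≥0∞ :=
  ∫⁻ z, entropy (condDistrib Y Z μ z) ∂(μ.map Z)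

/-- The width function `w_Q(ℓ) = Q(dP/dQ ≥ ℓ)` (for `P ≪ Q`). -/
def width {𝒳 : Type u} [MeasurableSpace 𝒳] (P Q : Measure 𝒳) (ℓ : ℝ) : ℝ :=
  Q.real {x | ENNReal.ofReal ℓ ≤ P.rnDeriv Q x}

/-- The channel simulation divergence `D_CS(P ‖ Q) = -∫_0^∞ w_Q(ℓ) log₂ w_Q(ℓ) dℓ`, in bits, for
probability measures `P ≪ Q`. The integrand is nonnegative because `0 ≤ w_Q ≤ 1`. -/
def channelSimDiv {𝒳 : Type u} [MeasurableSpace 𝒳] (P Q : Measure 𝒳) : ℝ≥0∞ :=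
  ∫⁻ ℓ in Set.Ioi (0 : ℝ), ENNReal.ofReal (-(width P Q ℓ * Real.logb 2 (width P Q ℓ)))

/-- The functional information `I_F(X; Y) = E_{y ∼ P_Y}[D_CS(P_{X | Y = y} ‖ P_X)]` of a pair
`(X, Y)` with joint law `P`, where `P_X = P.fst` and `P_Y = P.snd`. -/
def functionalInformation {𝒳 : Type u} {𝒴 : Type v} [MeasurableSpace 𝒳] [StandardBorelSpace 𝒳]
    [Nonempty 𝒳] [MeasurableSpace 𝒴] (P : Measure (𝒳 × 𝒴)) [IsFiniteMeasure P] : ℝ≥0∞ :=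
  ∫⁻ y, channelSimDiv (condDistrib Prod.fst Prod.snd P y) P.fst ∂P.snd

/-- A joint law `μ` of `(X, Y, Z)` in which `(X, Y)` has law `P` and `Z` is independent of `X`. -/
structure IsCommonRandomness {𝒳 : Type u} {𝒴 : Type v} {𝒵 : Type w} [MeasurableSpace 𝒳]
    [MeasurableSpace 𝒴] [MeasurableSpace 𝒵] (P : Measure (𝒳 × 𝒴)) (μ : Measure (𝒳 × 𝒴 × 𝒵)) :
    Prop where
  map_eq : μ.map (fun t => (t.1, t.2.1)) = P
  indep : IndepFun (fun t => t.1) (fun t => t.2.2) μ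

/-- `H* = inf_{Z ⊥ X} H(Y | Z)`: the infimum is over all random variables `Z` with values in a
standard Borel space that are jointly distributed with `(X, Y) ∼ P` and independent of `X`. -/
def minRate {𝒳 : Type u} {𝒴 : Type v} [MeasurableSpace 𝒳]
    [MeasurableSpace 𝒴] [StandardBorelSpace 𝒴] [Nonempty 𝒴] (P : Measure (𝒳 × 𝒴)) : ℝ≥0∞ :=
  sInf {h | ∃ (𝒵 : Type w) (_ : MeasurableSpace 𝒵) (_ : StandardBorelSpace 𝒵)
    (μ : Measure (𝒳 × 𝒴 × 𝒵)) (_ : IsProbabilityMeasure μ),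
    IsCommonRandomness P μ ∧ h = condEntropy (fun t => t.2.1) (fun t => t.2.2) μ}

/-- A stochastic code (relative entropy code) for the channel `W`: a law for the common randomness
`Z`, an encoder `enc : 𝒳 × 𝒵 → {0,1}*` and a decoder `dec : {0,1}* × 𝒵 → 𝒴`, both measurable (with
the discrete σ-algebra on strings), such that `dec (enc (x, Z), Z) ∼ W x` for every input `x`. -/
structure StochasticCode {𝒳 : Type u} {𝒴 : Type v} [MeasurableSpace 𝒳] [MeasurableSpace 𝒴]
    (W : Kernel 𝒳 𝒴) (𝒵 : Type w) [MeasurableSpace 𝒵] where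
  law : Measure 𝒵
  isProbabilityMeasure_law : IsProbabilityMeasure law
  enc : 𝒳 → 𝒵 → List Bool
  dec : List Bool → 𝒵 → 𝒴
  measurableSet_enc : ∀ s, MeasurableSet {p : 𝒳 × 𝒵 | enc p.1 p.2 = s}
  measurable_dec : ∀ s, Measurable (dec s)
  map_eq : ∀ x, law.map (fun z => dec (enc x z) z) = W x

attribute [instance] StochasticCode.isProbabilityMeasure_law

/-- The rate `H(Y | Z)` of a stochastic code on an input `X ∼ P_X` independent of the common
randomness `Z`, where `Y = dec (enc (X, Z), Z)`. -/
def StochasticCode.rate {𝒳 : Type u} {𝒴 : Type v} {𝒵 : Type w} [MeasurableSpace 𝒳]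
    [MeasurableSpace 𝒴] [StandardBorelSpace 𝒴] [Nonempty 𝒴] [MeasurableSpace 𝒵]
    {W : Kernel 𝒳 𝒴} (C : StochasticCode W 𝒵) (PX : Measure 𝒳) [IsProbabilityMeasure PX] : ℝ≥0∞ :=
  condEntropy (fun p : 𝒳 × 𝒵 => C.dec (C.enc p.1 p.2) p.2) Prod.snd (PX.prod C.law)

/-- The minimum rate over all stochastic codes for the channel `W` with input law `PX` and common
randomness in a standard Borel space. -/
def minCodeRate {𝒳 : Type u} {𝒴 : Type v} [MeasurableSpace 𝒳]
    [MeasurableSpace 𝒴] [StandardBorelSpace 𝒴] [Nonempty 𝒴]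
    (PX : Measure 𝒳) [IsProbabilityMeasure PX] (W : Kernel 𝒳 𝒴) : ℝ≥0∞ :=
  sInf {h | ∃ (𝒵 : Type w) (_ : MeasurableSpace 𝒵) (_ : StandardBorelSpace 𝒵)
    (C : StochasticCode W 𝒵), h = C.rate PX}

end

/-! Multiplying by `Real.log 2` turns all quantities into nats, so that `log e` becomes `1`. A
jointly measurable density `r x y` of `P` with respect to `P_X ⊗ P_Y` serves both as the density of
`W x` and, by Bayes, as that of `X` given `Y = y`. Write `w_y(l) = P_X(r(·, y) ≥ l)`.

Lower bound. Let `p` be the mass of the atom at `Y` under the law of `Y` given `Z`. Since `w_y`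
integrates to `1`, both `1 + I_F` and `1 + H(Y | Z)` are integrals over `0 < t < 1` against `dt /
t`: the first of `∫∫ min(t, w_y(l)) dl dP_Y`, the second of `E[min(1, t / p)]` (`lintegral_min_div`,
`lintegral_min_one_div`). The comparison then holds for each `t` separately
(`IsCommonRandomness.lintegral_min_le`). Independence of `X` and `Z` enters only through a change of
measure: on an atom of mass `p`, the joint law is at most `1 / p` times the law with `X` made
independent of `(Y, Z)` (`IsCommonRandomness.lintegral_le`).

Middle inequality. The common randomness of a code, together with input and output, is admissible in
the infimum `H*`.

Upper bound. Rejection sampling from independent proposals `(y, u)`, with `u` uniform on `(0, b]`,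
accepts when `u ≤ r x y`. The acceptance probability is `1 / b` for every input. Given `Z`, the
output is a function of the first accepted index, whose conditional law is `π_k`. Let `α_k` be the
`P_X`-probability of accepting proposal `k`, and `q = 1 - 1 / b`. Comparing `π_k` with `α_k q ^ k`
through `log x ≤ x - 1` (`mul_nats_add_le`) bounds the entropy by the mean of `-log α_k`, which
yields `I_F`, plus that of `-log q ^ k`, which is at most one nat because the index is geometric. -/

/-! ### Surprisal in nats and its threshold integrals -/

/-- The surprisal in nats, with value `∞` at `0`. -/
noncomputable def nats (p : ℝ≥0∞) : ℝ≥0∞ :=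
  if p = 0 then ∞ else ENNReal.ofReal (-Real.log p.toReal)

theorem measurable_nats : Measurable nats := by
  unfold nats
  refine Measurable.ite (measurableSet_singleton 0) measurable_const ?_
  fun_prop

theorem antitoneOn_nats : AntitoneOn nats (Set.Iic 1) := by
  intro a ha b hb hab
  unfold nats
  by_cases h : a = 0
  · simp [h]
  have hb0 : b ≠ 0 := fun h' => h (le_antisymm (h' ▸ hab) zero_le)
  rw [if_neg h, if_neg hb0]
  apply ENNReal.ofReal_le_ofReal
  have hbt : b ≠ ∞ := ne_top_of_le_ne_top ENNReal.one_ne_top hb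
  have := Real.log_le_log (ENNReal.toReal_pos h (ne_top_of_le_ne_top hbt hab))
    (ENNReal.toReal_mono hbt hab)
  linarith

theorem ofReal_log_two_mul_surprisal (p : ℝ≥0∞) :
    ENNReal.ofReal (Real.log 2) * surprisal p = nats p := by
  have h2 : 0 < Real.log 2 := Real.log_pos one_lt_two
  unfold surprisal nats
  split_ifs
  · rw [ENNReal.mul_top (by simpa using h2)]
  · rw [← ENNReal.ofReal_mul h2.le, Real.logb]
    congr 1
    field_simp

theorem ofReal_log_two_mul_ofReal_mul_logb {p : ℝ≥0∞} (hp : p ≤ 1) :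
    ENNReal.ofReal (Real.log 2) * ENNReal.ofReal (-(p.toReal * Real.logb 2 p.toReal)) =
      p * nats p := by
  have h2 : 0 < Real.log 2 := Real.log_pos one_lt_two
  by_cases h : p = 0
  · simp [h]
  have hpt : p ≠ ∞ := ne_top_of_le_ne_top ENNReal.one_ne_top hp
  unfold nats
  rw [if_neg h, ← ENNReal.ofReal_mul h2.le]
  nth_rw 3 [← ENNReal.ofReal_toReal hpt]
  rw [← ENNReal.ofReal_mul ENNReal.toReal_nonneg, Real.logb]
  congr 1
  field_simp

/-- Splitting at `t = p`, the integrand is `1` below and `p / t` above. This writes `w (1 + nats w)`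
as a superposition of the truncations `min t w`. -/
theorem lintegral_min_div {p : ℝ≥0∞} (hp : p ≤ 1) :
    ∫⁻ t in Set.Ioo (0 : ℝ) 1, min (ENNReal.ofReal t) p / ENNReal.ofReal t = p * (1 + nats p) := by
  by_cases h : p = 0
  · simp [h]
  have hpt : p ≠ ∞ := ne_top_of_le_ne_top ENNReal.one_ne_top hp
  obtain ⟨q, hq, rfl⟩ : ∃ q : ℝ, 0 < q ∧ p = ENNReal.ofReal q :=
    ⟨p.toReal, ENNReal.toReal_pos h hpt, (ENNReal.ofReal_toReal hpt).symm⟩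
  have hq1 : q ≤ 1 := by simpa using hp
  rw [restrict_Ioo_eq_restrict_Ioc, ← Set.Ioc_union_Ioc_eq_Ioc hq.le hq1,
    lintegral_union measurableSet_Ioc (Set.Ioc_disjoint_Ioc_of_le le_rfl), mul_add, mul_one]
  congr 1
  · rw [setLIntegral_congr_fun (g := fun _ => 1) measurableSet_Ioc]
    · simp
    · intro t ht
      have h1 : ENNReal.ofReal t ≤ ENNReal.ofReal q := ENNReal.ofReal_le_ofReal ht.2
      simp only [min_eq_left h1]
      exact ENNReal.div_self (by simpa using ht.1) ENNReal.ofReal_ne_top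
  · rw [setLIntegral_congr_fun (g := fun t => ENNReal.ofReal (q * t⁻¹)) measurableSet_Ioc]
    · have hi : IntegrableOn (fun t : ℝ => q * t⁻¹) (Set.Ioc q 1) := by
        rw [← intervalIntegrable_iff_integrableOn_Ioc_of_le hq1]
        apply IntervalIntegrable.const_mul
        rw [intervalIntegrable_inv_iff]
        right
        simp [Set.uIcc_of_le hq1, hq]
      rw [← ofReal_integral_eq_lintegral_ofReal hi, nats, if_neg h, ENNReal.toReal_ofReal hq.le,
        ← ENNReal.ofReal_mul hq.le, ← intervalIntegral.integral_of_le hq1,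
        intervalIntegral.integral_const_mul, integral_inv_of_pos hq one_pos]
      · simp
      · filter_upwards [self_mem_ae_restrict measurableSet_Ioc] with t ht
        have : 0 < t := hq.trans ht.1
        simp only [Pi.zero_apply]; positivity
    · intro t ht
      have h1 : ENNReal.ofReal q ≤ ENNReal.ofReal t := ENNReal.ofReal_le_ofReal ht.1.le
      simp only [min_eq_right h1]
      rw [← ENNReal.ofReal_div_of_pos (hq.trans ht.1), div_eq_mul_inv]

theorem lintegral_min_one_div_of_ne_zero {p : ℝ≥0∞} (hp : p ≤ 1) (h : p ≠ 0) :
    ∫⁻ t in Set.Ioo (0 : ℝ) 1, min 1 (ENNReal.ofReal t / p) / ENNReal.ofReal t = 1 + nats p := by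
  have hpt : p ≠ ∞ := ne_top_of_le_ne_top ENNReal.one_ne_top hp
  rw [← ENNReal.mul_right_inj h hpt, ← lintegral_min_div hp, ← lintegral_const_mul _ (by fun_prop)]
  congr 1 with t
  rw [← mul_div_assoc, mul_min, mul_one, ENNReal.mul_div_cancel h hpt, min_comm]

/-- For `p ≠ 0` this is the previous identity divided by `p`. At `p = 0` both sides are infinite:
the integral decreases in `p`, and `p = exp (-a)` already gives at least `a`. This case covers
conditional laws that are not discrete. -/
theorem lintegral_min_one_div {p : ℝ≥0∞} (hp : p ≤ 1) :
    ∫⁻ t in Set.Ioo (0 : ℝ) 1, min 1 (ENNReal.ofReal t / p) / ENNReal.ofReal t = 1 + nats p := by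
  by_cases h : p = 0
  swap
  · exact lintegral_min_one_div_of_ne_zero hp h
  subst h
  rw [nats, if_pos rfl, add_top]
  apply ENNReal.eq_top_of_forall_nnreal_le
  intro a
  have h1 : ENNReal.ofReal (Real.exp (-a)) ≤ 1 := by simp
  calc (a : ℝ≥0∞) ≤ 1 + nats (ENNReal.ofReal (Real.exp (-a))) := by
        rw [nats, if_neg (by simpa using Real.exp_pos _),
          ENNReal.toReal_ofReal (Real.exp_pos _).le, Real.log_exp, neg_neg, ENNReal.ofReal_coe_nnreal]
        exact le_add_self
    _ = _ := (lintegral_min_one_div_of_ne_zero h1 (by simpa using Real.exp_pos _)).symm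
    _ ≤ _ := by
        gcongr
        exact zero_le

/-- This is `log x ≤ x - 1` at `x = a b / p`, multiplied by `p`: a pointwise Gibbs inequality
against the unnormalised weight `a b`. The linear terms are kept because they cancel only after
summing and averaging. -/
theorem mul_nats_add_le {a b p : ℝ≥0∞} (ha : a ≤ 1) (hb : b ≤ 1) (hb0 : b ≠ 0) (hpa : p ≤ a) :
    p * nats p + p ≤ p * nats a + p * nats b + a * b := by
  by_cases h : p = 0
  · simp [h]
  have ha0 : a ≠ 0 := fun h' => h (le_antisymm (h' ▸ hpa) zero_le)
  have hp1 := hpa.trans ha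
  lift a to ℝ≥0 using ne_top_of_le_ne_top ENNReal.one_ne_top ha
  lift b to ℝ≥0 using ne_top_of_le_ne_top ENNReal.one_ne_top hb
  lift p to ℝ≥0 using ne_top_of_le_ne_top ENNReal.one_ne_top hp1
  simp only [nats, if_neg h, if_neg ha0, if_neg hb0, ENNReal.coe_toReal]
  simp only [← ENNReal.ofReal_coe_nnreal]
  simp only [← ENNReal.ofReal_coe_nnreal, ENNReal.ofReal_le_one, ne_eq, ENNReal.ofReal_eq_zero,
    not_le] at *
  have l1 := Real.log_nonpos ha0.le ha
  have l2 := Real.log_nonpos hb0.le hb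
  have l3 := Real.log_nonpos h.le hp1
  rw [← ENNReal.ofReal_mul h.le, ← ENNReal.ofReal_mul h.le, ← ENNReal.ofReal_mul h.le,
    ← ENNReal.ofReal_mul ha0.le, ← ENNReal.ofReal_add (by nlinarith) h.le,
    ← ENNReal.ofReal_add (by nlinarith) (by nlinarith),
    ← ENNReal.ofReal_add (by nlinarith) (by positivity)]
  apply ENNReal.ofReal_le_ofReal
  have key := Real.log_le_sub_one_of_pos (x := (a * b / p : ℝ)) (by positivity)
  rw [Real.log_div (by positivity) h.ne', Real.log_mul ha0.ne' hb0.ne'] at key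
  have := mul_le_mul_of_nonneg_left key h.le
  have e : (p : ℝ) * (a * b / p - 1) = a * b - p := by field_simp
  nlinarith

/-! ### Layer-cake integrals -/

theorem volume_restrict_Ioi_ofReal_le (c : ℝ≥0∞) :
    volume.restrict (Set.Ioi (0 : ℝ)) {l | ENNReal.ofReal l ≤ c} = c := by
  rw [Measure.restrict_apply (measurableSet_le (by fun_prop) measurable_const)]
  by_cases hc : c = ∞
  · subst hc
    simp
  · have : {l : ℝ | ENNReal.ofReal l ≤ c} ∩ Set.Ioi 0 = Set.Ioc 0 c.toReal := by
      ext l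
      simp only [Set.mem_inter_iff, Set.mem_ofPred_eq, Set.mem_Ioi, Set.mem_Ioc,
        ENNReal.ofReal_le_iff_le_toReal hc]
      tauto
    rw [this]
    simp [ENNReal.ofReal_toReal hc]

theorem volume_restrict_Ioi_ofReal_mem_Ioc_le (c d : ℝ≥0∞) :
    volume.restrict (Set.Ioi (0 : ℝ)) {l | c < ENNReal.ofReal l ∧ ENNReal.ofReal l ≤ d} ≤ d - c := by
  by_cases hc : c = ∞
  · subst hc
    simp
  have hm : MeasurableSet {l : ℝ | ENNReal.ofReal l ≤ c} :=
    measurableSet_le (by fun_prop) measurable_const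
  rcases le_or_gt c d with h | h
  · apply ENNReal.le_sub_of_add_le_right hc
    calc _ = _ + volume.restrict (Set.Ioi (0 : ℝ)) {l | ENNReal.ofReal l ≤ c} := by
          rw [volume_restrict_Ioi_ofReal_le]
      _ ≤ volume.restrict (Set.Ioi (0 : ℝ)) {l | ENNReal.ofReal l ≤ d} := ?_
      _ = d := volume_restrict_Ioi_ofReal_le d
    rw [← measure_union _ hm]
    · apply measure_mono
      rintro l (hl | hl)
      exacts [hl.2, le_trans hl h]
    · rw [Set.disjoint_left]
      exact fun l h1 h2 => absurd h1.1 (not_lt.2 h2)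
  · have : {l : ℝ | c < ENNReal.ofReal l ∧ ENNReal.ofReal l ≤ d} = ∅ := by
      ext l
      simp only [Set.mem_ofPred_eq, Set.mem_empty_iff_false, iff_false, not_and, not_le]
      exact fun h1 => h.trans h1
    simp [this]

section Layercake
variable {𝒳 : Type u} [MeasurableSpace 𝒳] {ν : Measure 𝒳} [SFinite ν] {f : 𝒳 → ℝ≥0∞}

theorem lintegral_measure_ofReal_le (hf : Measurable f) :
    ∫⁻ l in Set.Ioi (0 : ℝ), ν {x | ENNReal.ofReal l ≤ f x} = ∫⁻ x, f x ∂ν := by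
  have hm : MeasurableSet {p : ℝ × 𝒳 | ENNReal.ofReal p.1 ≤ f p.2} :=
    measurableSet_le (by fun_prop) (by fun_prop)
  have h1 := Measure.prod_apply (μ := volume.restrict (Set.Ioi (0 : ℝ))) (ν := ν) hm
  have h2 := Measure.prod_apply_symm (μ := volume.restrict (Set.Ioi (0 : ℝ))) (ν := ν) hm
  simp only [Set.preimage_ofPred_eq, volume_restrict_Ioi_ofReal_le] at h1 h2
  rw [← h1, h2]

/-- Levels `l ≤ c` are charged `t` each; levels above `c` are charged the measure of the superlevel
set, which integrates to the excess of `f` over `c`. The level `c` is free and is chosen later,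
depending on `y`. -/
theorem lintegral_min_measure_ofReal_le (hf : Measurable f) (t c : ℝ≥0∞) :
    ∫⁻ l in Set.Ioi (0 : ℝ), min t (ν {x | ENNReal.ofReal l ≤ f x}) ≤
      t * c + ∫⁻ x, (f x - c) ∂ν := by
  have hm : MeasurableSet {p : ℝ × 𝒳 | c < ENNReal.ofReal p.1 ∧ ENNReal.ofReal p.1 ≤ f p.2} :=
    (measurableSet_lt (f := fun _ => c) (g := fun p : ℝ × 𝒳 => ENNReal.ofReal p.1)
      measurable_const (by fun_prop)).inter
      (measurableSet_le (f := fun p : ℝ × 𝒳 => ENNReal.ofReal p.1) (g := fun p => f p.2)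
        (by fun_prop) (by fun_prop))
  have h1 := Measure.prod_apply (μ := volume.restrict (Set.Ioi (0 : ℝ))) (ν := ν) hm
  have h2 := Measure.prod_apply_symm (μ := volume.restrict (Set.Ioi (0 : ℝ))) (ν := ν) hm
  simp only [Set.preimage_ofPred_eq] at h1 h2
  have hs : MeasurableSet {l : ℝ | ENNReal.ofReal l ≤ c} :=
    measurableSet_le (by fun_prop) measurable_const
  calc ∫⁻ l in Set.Ioi (0 : ℝ), min t (ν {x | ENNReal.ofReal l ≤ f x})
      ≤ ∫⁻ l in Set.Ioi (0 : ℝ), ({l : ℝ | ENNReal.ofReal l ≤ c}.indicator (fun _ => t) l +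
          ν {x | c < ENNReal.ofReal l ∧ ENNReal.ofReal l ≤ f x}) := by
        gcongr with l
        by_cases h : ENNReal.ofReal l ≤ c
        · rw [Set.indicator_of_mem (by exact h)]
          exact (min_le_left _ _).trans le_self_add
        · rw [Set.indicator_of_notMem (by exact h), zero_add]
          refine (min_le_right _ _).trans (measure_mono fun x hx => ⟨not_le.1 h, hx⟩)
    _ ≤ t * c + ∫⁻ x, (f x - c) ∂ν := by
        rw [lintegral_add_left (measurable_const.indicator hs), lintegral_indicator_const hs,
          volume_restrict_Ioi_ofReal_le, ← h1, h2]
        gcongr with x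
        exact volume_restrict_Ioi_ofReal_mem_Ioc_le c (f x)

end Layercake

/-! ### The joint density and the functional information -/

section Density
variable {𝒳 : Type u} {𝒴 : Type v} [MeasurableSpace 𝒳] [MeasurableSpace 𝒴]

/-- Truncating the kernel derivative at `M` changes it only on null sets, and makes the bound hold
at every point while keeping joint measurability. -/
theorem exists_bounded_density [StandardBorelSpace 𝒴] (W : Kernel 𝒳 𝒴) [IsFiniteKernel W]
    (ν : Measure 𝒴) [IsFiniteMeasure ν] (M : ℝ≥0∞)
    (hM : ∀ x, W x ≪ ν ∧ ∀ᵐ y ∂ν, (W x).rnDeriv ν y ≤ M) :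
    ∃ r : 𝒳 → 𝒴 → ℝ≥0∞, Measurable (Function.uncurry r) ∧ (∀ x y, r x y ≤ M) ∧
      ∀ x, W x = ν.withDensity (r x) := by
  refine ⟨fun x y => min (W.rnDeriv (Kernel.const 𝒳 ν) x y) M, ?_, fun x y => min_le_right _ _, ?_⟩
  · exact (Kernel.measurable_rnDeriv W (Kernel.const 𝒳 ν)).min measurable_const
  · intro x
    have h := Kernel.rnDeriv_eq_rnDeriv_measure (κ := W) (η := Kernel.const 𝒳 ν) (a := x)
    rw [Kernel.const_apply] at h
    rw [← Measure.withDensity_rnDeriv_eq (W x) ν (hM x).1]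
    apply withDensity_congr_ae
    filter_upwards [h, (hM x).2] with y h1 h2
    rw [h1, min_eq_left h2]

theorem compProd_eq_prod_withDensity {μ : Measure 𝒳} [SFinite μ] {ν : Measure 𝒴} [IsFiniteMeasure ν]
    {W : Kernel 𝒳 𝒴} {r : 𝒳 → 𝒴 → ℝ≥0∞} (hr : Measurable (Function.uncurry r)) {M : ℝ≥0∞}
    (hrM : ∀ x y, r x y ≤ M) (hM : M ≠ ∞) (hW : ∀ x, W x = ν.withDensity (r x)) :
    μ ⊗ₘ W = (μ.prod ν).withDensity (Function.uncurry r) := by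
  have : W = (Kernel.const 𝒳 ν).withDensity r := by
    ext1 x
    rw [Kernel.withDensity_apply _ hr, Kernel.const_apply, hW]
  have := Kernel.isFiniteKernel_withDensity_of_bounded (Kernel.const 𝒳 ν) hM hrM
  subst W
  rw [Measure.compProd_withDensity hr, Measure.compProd_const]
  rfl

variable [StandardBorelSpace 𝒳] [Nonempty 𝒳] {P : Measure (𝒳 × 𝒴)} [IsProbabilityMeasure P]
  {r : 𝒳 → 𝒴 → ℝ≥0∞}

/-- Bayes' rule: the density of the joint law with respect to the product of its marginals can be
disintegrated along either coordinate. -/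
theorem condDistrib_fst_snd_ae_eq_withDensity (hr : Measurable (Function.uncurry r)) {M : ℝ≥0∞}
    (hrM : ∀ x y, r x y ≤ M) (hM : M ≠ ∞)
    (hP : P = (P.fst.prod P.snd).withDensity (Function.uncurry r)) :
    ∀ᵐ y ∂P.snd, condDistrib Prod.fst Prod.snd P y = P.fst.withDensity (fun x => r x y) := by
  have hr' : Measurable (Function.uncurry fun y x => r x y) := hr.comp measurable_swap
  have := Kernel.isFiniteKernel_withDensity_of_bounded (f := fun y x => r x y)
    (Kernel.const 𝒴 P.fst) hM (fun y x => hrM x y)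
  have h := condDistrib_ae_eq_of_measure_eq_compProd (μ := P) (Y := Prod.fst) Prod.snd
    measurable_fst.aemeasurable
    (κ := (Kernel.const 𝒴 P.fst).withDensity (fun y x => r x y)) ?_
  · filter_upwards [h] with y hy
    rw [hy, Kernel.withDensity_apply _ hr', Kernel.const_apply]
  · change P.map Prod.swap = P.snd ⊗ₘ _
    rw [Measure.compProd_withDensity hr', Measure.compProd_const]
    nth_rw 1 [hP]
    ext s hs
    rw [Measure.map_apply measurable_swap hs, withDensity_apply _ (measurable_swap hs),
      withDensity_apply _ hs, ← Measure.prod_swap, setLIntegral_map (measurable_swap hs) hr measurable_swap]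
    rfl

theorem lintegral_density_ae_eq_one (hr : Measurable (Function.uncurry r)) {M : ℝ≥0∞}
    (hrM : ∀ x y, r x y ≤ M) (hM : M ≠ ∞)
    (hP : P = (P.fst.prod P.snd).withDensity (Function.uncurry r)) :
    ∀ᵐ y ∂P.snd, ∫⁻ x, r x y ∂P.fst = 1 := by
  filter_upwards [condDistrib_fst_snd_ae_eq_withDensity hr hrM hM hP] with y hy
  have : condDistrib Prod.fst Prod.snd P y Set.univ = 1 := measure_univ
  rwa [hy, withDensity_apply _ MeasurableSet.univ, Measure.restrict_univ] at this

theorem ofReal_log_two_mul_functionalInformation (hr : Measurable (Function.uncurry r)) {M : ℝ≥0∞}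
    (hrM : ∀ x y, r x y ≤ M) (hM : M ≠ ∞)
    (hP : P = (P.fst.prod P.snd).withDensity (Function.uncurry r)) :
    ENNReal.ofReal (Real.log 2) * functionalInformation P =
      ∫⁻ y, (∫⁻ l in Set.Ioi (0 : ℝ), P.fst {x | ENNReal.ofReal l ≤ r x y} *
        nats (P.fst {x | ENNReal.ofReal l ≤ r x y})) ∂P.snd := by
  rw [functionalInformation, ← lintegral_const_mul' _ _ ENNReal.ofReal_ne_top]
  apply lintegral_congr_ae
  filter_upwards [condDistrib_fst_snd_ae_eq_withDensity hr hrM hM hP] with y hy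
  rw [channelSimDiv, ← lintegral_const_mul' _ _ ENNReal.ofReal_ne_top]
  congr 1 with l
  have hry : Measurable fun x => r x y := hr.comp (measurable_id.prodMk measurable_const)
  have : P.fst {x | ENNReal.ofReal l ≤ (condDistrib Prod.fst Prod.snd P y).rnDeriv P.fst x} =
      P.fst {x | ENNReal.ofReal l ≤ r x y} := by
    rw [hy]
    apply measure_congr
    filter_upwards [Measure.rnDeriv_withDensity P.fst hry] with x hx
    apply propext
    change ENNReal.ofReal l ≤ _ ↔ ENNReal.ofReal l ≤ _
    rw [hx]
  rw [width, measureReal_def, this, ofReal_log_two_mul_ofReal_mul_logb prob_le_one]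

end Density

/-! ### The lower bound for arbitrary common randomness -/

section Atoms
variable {𝒴 : Type v} {𝒵 : Type w} [MeasurableSpace 𝒴] [MeasurableSpace 𝒵]

theorem measurable_kernel_singleton [MeasurableEq 𝒴] (ρ : Kernel 𝒵 𝒴) [IsSFiniteKernel ρ] :
    Measurable fun q : 𝒵 × 𝒴 => ρ q.1 {q.2} := by
  have hs : MeasurableSet {p : (𝒵 × 𝒴) × 𝒴 | p.2 = p.1.2} :=
    measurableSet_eq_fun (by fun_prop) (by fun_prop)
  exact Kernel.measurable_kernel_prodMk_left (κ := ρ.comap Prod.fst measurable_fst)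
    (t := {p : (𝒵 × 𝒴) × 𝒴 | p.2 = p.1.2}) hs

theorem min_one_div_eq_indicator_add (p t : ℝ≥0∞) :
    min 1 (t / p) =
      (Set.Iio t).indicator (fun _ => 1) p + t * (Set.Ici t).indicator (fun p => p⁻¹) p := by
  rcases lt_or_ge p t with h | h
  · rw [Set.indicator_of_mem (by exact h), Set.indicator_of_notMem (by simpa using h), mul_zero,
      add_zero, min_eq_left]
    by_cases hp : p = 0
    · subst hp
      rw [ENNReal.div_zero h.ne']
      exact le_top
    · rw [ENNReal.le_div_iff_mul_le (Or.inl hp) (Or.inl (ne_top_of_lt h)), one_mul]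
      exact h.le
  · rw [Set.indicator_of_notMem (by simpa using h), Set.indicator_of_mem (by exact h), zero_add,
      div_eq_mul_inv, min_eq_right]
    rw [← div_eq_mul_inv]
    exact ENNReal.div_le_of_le_mul (by rwa [one_mul])

end Atoms

theorem IsCommonRandomness.map_fst_eq {𝒳 : Type u} {𝒴 : Type v} {𝒵 : Type w}
    [MeasurableSpace 𝒳] [MeasurableSpace 𝒴] [MeasurableSpace 𝒵] {P : Measure (𝒳 × 𝒴)}
    {μ : Measure (𝒳 × 𝒴 × 𝒵)} (h : IsCommonRandomness P μ) :
    μ.map (fun t => t.1) = P.fst := by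
  rw [← h.map_eq, Measure.fst, Measure.map_map measurable_fst (by fun_prop)]
  rfl

theorem IsCommonRandomness.map_snd_eq {𝒳 : Type u} {𝒴 : Type v} {𝒵 : Type w}
    [MeasurableSpace 𝒳] [MeasurableSpace 𝒴] [MeasurableSpace 𝒵] {P : Measure (𝒳 × 𝒴)}
    {μ : Measure (𝒳 × 𝒴 × 𝒵)} (h : IsCommonRandomness P μ) :
    μ.map (fun t => t.2.1) = P.snd := by
  rw [← h.map_eq, Measure.snd, Measure.map_map measurable_snd (by fun_prop)]
  rfl

section Independent
variable {𝒳 : Type u} {𝒴 : Type v} {𝒵 : Type w} [MeasurableSpace 𝒳] [MeasurableSpace 𝒴]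
  [StandardBorelSpace 𝒴] [Nonempty 𝒴] [MeasurableSpace 𝒵] {P : Measure (𝒳 × 𝒴)}
  [IsProbabilityMeasure P] {μ : Measure (𝒳 × 𝒴 × 𝒵)} [IsProbabilityMeasure μ]

omit [Nonempty 𝒴] in
/-- Since `Z` is independent of `X`, on the atoms of `P_{Y | Z}` the law of `(X, Y, Z)` is dominated
by `P_X ⊗ P_{Y, Z}` divided by the mass of the atom. -/
theorem IsCommonRandomness.lintegral_le (h : IsCommonRandomness P μ) {ρ : Kernel 𝒵 𝒴}
    [IsFiniteKernel ρ] {F : 𝒳 × 𝒵 × 𝒴 → ℝ≥0∞} (hF : Measurable F)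
    (hF0 : ∀ x z y, ρ z {y} = 0 → F (x, z, y) = 0) :
    ∫⁻ s, F (s.1, s.2.2, s.2.1) ∂μ ≤
      ∫⁻ q, (ρ q.1 {q.2})⁻¹ * ∫⁻ x, F (x, q) ∂P.fst ∂(μ.map (fun t => t.2.2) ⊗ₘ ρ) := by
  have hp := measurable_kernel_singleton ρ
  have hm : Measurable fun a : (𝒳 × 𝒵) × 𝒴 => (ρ a.1.2 {a.2})⁻¹ * F (a.1.1, a.1.2, a.2) := by
    have : Measurable fun a : (𝒳 × 𝒵) × 𝒴 => ρ a.1.2 {a.2} :=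
      hp.comp (f := fun a : (𝒳 × 𝒵) × 𝒴 => (a.1.2, a.2)) (by fun_prop)
    exact this.inv.mul (hF.comp (by fun_prop))
  have hG : Measurable fun a : 𝒳 × 𝒵 => ∫⁻ y, (ρ a.2 {y})⁻¹ * F (a.1, a.2, y) ∂ρ a.2 :=
    Measurable.lintegral_kernel_prod_right' (κ := ρ.comap Prod.snd measurable_snd) hm
  have hprod : μ.map (fun t => (t.1, t.2.2)) = P.fst.prod (μ.map fun t => t.2.2) := by
    rw [← h.map_fst_eq]
    exact (indepFun_iff_map_prod_eq_prod_map_map (by fun_prop) (by fun_prop)).1 h.indep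
  calc ∫⁻ s, F (s.1, s.2.2, s.2.1) ∂μ
      ≤ ∫⁻ s, ∫⁻ y, (ρ s.2.2 {y})⁻¹ * F (s.1, s.2.2, y) ∂ρ s.2.2 ∂μ := by
        gcongr with s
        -- Only the atom at the actual value of `Y` is kept; its mass cancels the inverse.
        refine le_trans ?_ (setLIntegral_le_lintegral {s.2.1} _)
        rw [lintegral_singleton, mul_comm, ← mul_assoc]
        by_cases h0 : ρ s.2.2 {s.2.1} = 0
        · rw [hF0 _ _ _ h0]
          exact zero_le
        · rw [ENNReal.mul_inv_cancel h0 (measure_ne_top _ _), one_mul]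
    _ = ∫⁻ a, ∫⁻ y, (ρ a.2 {y})⁻¹ * F (a.1, a.2, y) ∂ρ a.2 ∂(μ.map fun t => (t.1, t.2.2)) :=
        (lintegral_map (g := fun t : 𝒳 × 𝒴 × 𝒵 => (t.1, t.2.2)) hG (by fun_prop)).symm
    _ = ∫⁻ z, ∫⁻ x, ∫⁻ y, (ρ z {y})⁻¹ * F (x, z, y) ∂ρ z ∂P.fst ∂(μ.map fun t => t.2.2) := by
        rw [hprod, lintegral_prod_symm _ hG.aemeasurable]
    _ = ∫⁻ z, ∫⁻ y, (ρ z {y})⁻¹ * ∫⁻ x, F (x, z, y) ∂P.fst ∂ρ z ∂(μ.map fun t => t.2.2) := by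
        congr 1 with z
        rw [lintegral_lintegral_swap]
        · congr 1 with y
          exact lintegral_const_mul _ (hF.comp measurable_prodMk_right)
        · exact (hm.comp (f := fun a : 𝒳 × 𝒴 => ((a.1, z), a.2)) (by fun_prop)).aemeasurable
    _ = _ := by
        rw [Measure.lintegral_compProd]
        exact hp.inv.mul (hF.lintegral_prod_left' (μ := P.fst))

variable {r : 𝒳 → 𝒴 → ℝ≥0∞}

/-- With `p` the conditional mass of the atom at `Y`, let `g = 1 / p` where `p ≥ t` and `0`
elsewhere, and let `c(y) = E[g | Y = y]`. Test the joint law on `A = {r > c}`. Its probability is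
exactly `∫∫ (r - c)⁺` plus the mean of `g · P_X(A_Y)`, while the change of measure bounds it by `P(p
< t)` plus the same mean. Hence `∫∫ (r - c)⁺ ≤ P(p < t)`, and cutting the layer-cake integral at
`c(y)` gives `t E[g] + P(p < t) = E[min(1, t / p)]`. -/
theorem IsCommonRandomness.lintegral_min_le (h : IsCommonRandomness P μ)
    (hr : Measurable (Function.uncurry r))
    (hP : P = (P.fst.prod P.snd).withDensity (Function.uncurry r)) {t : ℝ≥0∞} (ht0 : t ≠ 0) :
    ∫⁻ y, (∫⁻ l in Set.Ioi (0 : ℝ), min t (P.fst {x | ENNReal.ofReal l ≤ r x y})) ∂P.snd ≤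
      ∫⁻ z, ∫⁻ y, min 1 (t / condDistrib (fun s => s.2.1) (fun s => s.2.2) μ z {y})
        ∂(condDistrib (fun s => s.2.1) (fun s => s.2.2) μ z) ∂(μ.map fun s => s.2.2) := by
  set ρ : Kernel 𝒵 𝒴 := condDistrib (fun s : 𝒳 × 𝒴 × 𝒵 => s.2.1) (fun s => s.2.2) μ
  set κ : Measure (𝒵 × 𝒴) := (μ.map fun s => s.2.2) ⊗ₘ ρ
  have hκ : κ = μ.map (fun s => (s.2.2, s.2.1)) := compProd_map_condDistrib (by fun_prop)
  have hκs : κ.map Prod.snd = P.snd := by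
    rw [hκ, Measure.map_map measurable_snd (by fun_prop), ← h.map_snd_eq]
    rfl
  have hp : Measurable fun q : 𝒵 × 𝒴 => ρ q.1 {q.2} := measurable_kernel_singleton ρ
  set g : 𝒵 × 𝒴 → ℝ≥0∞ := fun q => (Set.Ici t).indicator (fun p => p⁻¹) (ρ q.1 {q.2}) with hg
  have : IsProbabilityMeasure κ := by
    rw [hκ]
    exact Measure.isProbabilityMeasure_map (by fun_prop)
  have hgm : Measurable g := (measurable_inv.indicator measurableSet_Ici).comp hp
  have hgle : ∀ q, g q ≤ t⁻¹ := fun q => by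
    by_cases hq : t ≤ ρ q.1 {q.2}
    · simp [hg, hq]
    · simp [hg, hq]
  have : IsFiniteMeasure (κ.withDensity g) := isFiniteMeasure_withDensity
    (ne_top_of_le_ne_top (ENNReal.inv_ne_top.2 ht0)
      ((lintegral_mono hgle).trans (by rw [lintegral_const, measure_univ, mul_one])))
  set m : Measure 𝒴 := (κ.withDensity g).map Prod.snd with hm
  have hmac : m ≪ P.snd := by
    rw [← hκs]
    exact (withDensity_absolutelyContinuous κ g).map measurable_snd
  -- A version of the conditional expectation of `g` given `Y`.
  set c : 𝒴 → ℝ≥0∞ := m.rnDeriv P.snd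
  have hcm : Measurable c := Measure.measurable_rnDeriv _ _
  have hcint : ∀ f : 𝒴 → ℝ≥0∞, Measurable f → ∫⁻ y, c y * f y ∂P.snd = ∫⁻ q, g q * f q.2 ∂κ := by
    intro f hf
    calc ∫⁻ y, c y * f y ∂P.snd = ∫⁻ y, f y ∂m := by
          rw [← Measure.withDensity_rnDeriv_eq m P.snd hmac,
            lintegral_withDensity_eq_lintegral_mul _ hcm hf]
          rfl
      _ = ∫⁻ q, g q * f q.2 ∂κ := by
          rw [hm, lintegral_map hf measurable_snd,
            lintegral_withDensity_eq_lintegral_mul _ hgm (by fun_prop)]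
          rfl
  set A : Set (𝒳 × 𝒴) := {a | c a.2 < r a.1 a.2}
  have hAm : MeasurableSet A := measurableSet_lt (by fun_prop) hr
  have hAy : Measurable fun y => P.fst {x | (x, y) ∈ A} := measurable_measure_prodMk_right hAm
  -- On `A` the density splits as `r = (r - c) + c`; off `A` the truncated difference vanishes.
  have hPA : P A = ∫⁻ y, ∫⁻ x, (r x y - c y) ∂P.fst ∂P.snd
      + ∫⁻ q, g q * P.fst {x | (x, q.2) ∈ A} ∂κ := by
    rw [← hcint _ hAy, ← lintegral_add_right (g := fun y => c y * P.fst {x | (x, y) ∈ A}) _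
      (hcm.mul hAy)]
    nth_rw 1 [hP]
    rw [withDensity_apply _ hAm, ← lintegral_indicator hAm,
      lintegral_prod_symm _ (hr.indicator hAm).aemeasurable]
    congr 1 with y
    have hAy' : MeasurableSet {x | (x, y) ∈ A} := measurable_prodMk_right hAm
    rw [← lintegral_indicator_const hAy', ← lintegral_add_right _ (measurable_const.indicator hAy')]
    congr 1 with x
    by_cases hx : (x, y) ∈ A
    · rw [Set.indicator_of_mem hx, Set.indicator_of_mem (by exact hx), Function.uncurry_apply_pair,
        tsub_add_cancel_of_le (le_of_lt hx)]
    · rw [Set.indicator_of_notMem hx, Set.indicator_of_notMem (by exact hx), add_zero]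
      exact (tsub_eq_zero_of_le (not_lt.1 hx)).symm
  -- Atoms lighter than `t` are discarded at the cost of their total probability; on the others the
  -- change of measure applies with weight `g`.
  have hPA' : P A ≤ κ {q | ρ q.1 {q.2} < t} + ∫⁻ q, g q * P.fst {x | (x, q.2) ∈ A} ∂κ := by
    have hS : MeasurableSet {q : 𝒵 × 𝒴 | ρ q.1 {q.2} < t} := measurableSet_lt hp measurable_const
    have hB : MeasurableSet {a : 𝒳 × 𝒵 × 𝒴 | (a.1, a.2.2) ∈ A ∧ t ≤ ρ a.2.1 {a.2.2}} :=
      MeasurableSet.inter (hAm.preimage (f := fun a : 𝒳 × 𝒵 × 𝒴 => (a.1, a.2.2)) (by fun_prop))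
        (measurableSet_le measurable_const (hp.comp measurable_snd))
    have key := h.lintegral_le (ρ := ρ) (F := Set.indicator _ fun _ => 1)
      (measurable_const.indicator hB) (fun x z y h0 => by
        rw [Set.indicator_of_notMem]
        rintro ⟨-, h2⟩
        exact ht0 (le_antisymm (h2.trans h0.le) zero_le))
    calc P A = μ {s | (s.1, s.2.1) ∈ A} := by
          rw [← h.map_eq, Measure.map_apply (by fun_prop) hAm]
          rfl
      _ ≤ μ ({s | ρ s.2.2 {s.2.1} < t} ∪ {s | (s.1, s.2.1) ∈ A ∧ t ≤ ρ s.2.2 {s.2.1}}) := by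
          apply measure_mono
          intro s hs
          rcases lt_or_ge (ρ s.2.2 {s.2.1}) t with h1 | h1
          exacts [Or.inl h1, Or.inr ⟨hs, h1⟩]
      _ ≤ μ {s | ρ s.2.2 {s.2.1} < t} + μ {s | (s.1, s.2.1) ∈ A ∧ t ≤ ρ s.2.2 {s.2.1}} :=
          measure_union_le _ _
      _ = κ {q | ρ q.1 {q.2} < t} + ∫⁻ s, ({a : 𝒳 × 𝒵 × 𝒴 | (a.1, a.2.2) ∈ A ∧
            t ≤ ρ a.2.1 {a.2.2}}.indicator (fun _ => 1) (s.1, s.2.2, s.2.1)) ∂μ := by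
          congr 1
          · rw [hκ, Measure.map_apply (by fun_prop) hS]
            rfl
          · exact (lintegral_indicator_one
              (hB.preimage (f := fun s : 𝒳 × 𝒴 × 𝒵 => (s.1, s.2.2, s.2.1)) (by fun_prop))).symm
      _ ≤ _ := by
          gcongr
          refine key.trans (le_of_eq ?_)
          congr 1 with q
          by_cases hq : t ≤ ρ q.1 {q.2}
          · have hq' : MeasurableSet {x | (x, q.2) ∈ A} := measurable_prodMk_right hAm
            have e : g q = (ρ q.1 {q.2})⁻¹ := by simp [hg, hq]
            rw [e, ← lintegral_indicator_one hq']
            congr 2 with x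
            simp [Set.indicator, hq]
          · have e : g q = 0 := by simp [hg, hq]
            rw [e, zero_mul]
            simp [Set.indicator, hq]
  -- Finiteness, from `g ≤ 1 / t`, is what allows the common term to be cancelled.
  have hfin : ∫⁻ q, g q * P.fst {x | (x, q.2) ∈ A} ∂κ ≠ ∞ := by
    refine ne_top_of_le_ne_top (ENNReal.inv_ne_top.2 ht0) ((lintegral_mono (g := fun _ => t⁻¹)
      fun q => ?_).trans (by rw [lintegral_const, measure_univ, mul_one]))
    calc g q * P.fst {x | (x, q.2) ∈ A} ≤ t⁻¹ * 1 := mul_le_mul' (hgle q) prob_le_one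
      _ = t⁻¹ := mul_one _
  rw [hPA, ENNReal.add_le_add_iff_right hfin] at hPA'
  calc _ ≤ ∫⁻ y, (t * c y + ∫⁻ x, (r x y - c y) ∂P.fst) ∂P.snd := by
        gcongr with y
        exact lintegral_min_measure_ofReal_le (hr.comp (measurable_id.prodMk measurable_const)) _ _
    _ = t * ∫⁻ q, g q ∂κ + ∫⁻ y, ∫⁻ x, (r x y - c y) ∂P.fst ∂P.snd := by
        rw [lintegral_add_left (by fun_prop), lintegral_const_mul _ hcm]
        congr 2
        simpa using hcint (fun _ => 1) measurable_const
    _ ≤ t * ∫⁻ q, g q ∂κ + κ {q | ρ q.1 {q.2} < t} := by gcongr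
    _ = ∫⁻ q, min 1 (t / ρ q.1 {q.2}) ∂κ := by
        have hS : MeasurableSet {q : 𝒵 × 𝒴 | ρ q.1 {q.2} < t} := measurableSet_lt hp measurable_const
        rw [← lintegral_const_mul _ hgm, ← lintegral_indicator_one hS, add_comm,
          ← lintegral_add_right _ (by fun_prop)]
        congr 1 with q
        rw [min_one_div_eq_indicator_add]
        rfl
    _ = _ := Measure.lintegral_compProd (f := fun q => min 1 (t / ρ q.1 {q.2}))
        (measurable_const.min (measurable_const.div hp))

/-- The fixed-threshold inequality is integrated against `dt / t` over `(0, 1)`, with Tonelli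
exchanging the threshold with the other variables on both sides. -/
theorem IsCommonRandomness.functionalInformation_le [StandardBorelSpace 𝒳] [Nonempty 𝒳]
    (h : IsCommonRandomness P μ) (hr : Measurable (Function.uncurry r)) {M : ℝ≥0∞}
    (hrM : ∀ x y, r x y ≤ M) (hM : M ≠ ∞)
    (hP : P = (P.fst.prod P.snd).withDensity (Function.uncurry r)) :
    functionalInformation P ≤ condEntropy (fun t => t.2.1) (fun t => t.2.2) μ := by
  have h2 : 0 < Real.log 2 := Real.log_pos one_lt_two
  -- The added `1` is the integral of `w_y` on the left and the total probability on the right,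
  -- which completes both integrands to the forms given by the threshold identities.
  rw [← ENNReal.mul_le_mul_iff_right (a := ENNReal.ofReal (Real.log 2)) (by simpa using h2)
    ENNReal.ofReal_ne_top, ← ENNReal.add_le_add_iff_left ENNReal.one_ne_top]
  have hw : Measurable fun q : 𝒴 × ℝ => P.fst {x | ENNReal.ofReal q.2 ≤ r x q.1} :=
    measurable_measure_prodMk_left (s := {a : (𝒴 × ℝ) × 𝒳 | ENNReal.ofReal a.1.2 ≤ r a.2 a.1.1})
      (measurableSet_le (by fun_prop) (hr.comp (f := fun a : (𝒴 × ℝ) × 𝒳 => (a.2, a.1.1))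
        (by fun_prop)))
  set ρ : Kernel 𝒵 𝒴 := condDistrib (fun s : 𝒳 × 𝒴 × 𝒵 => s.2.1) (fun s => s.2.2) μ
  have hp : Measurable fun q : 𝒵 × 𝒴 => ρ q.1 {q.2} := measurable_kernel_singleton ρ
  have hwy : ∀ y, Measurable fun l : ℝ => P.fst {x | ENNReal.ofReal l ≤ r x y} := fun y =>
    hw.comp measurable_prodMk_left
  have hn := measurable_nats
  set lam : Measure ℝ := volume.restrict (Set.Ioi 0)
  set tau : Measure ℝ := volume.restrict (Set.Ioo 0 1)
  set κ : Measure (𝒵 × 𝒴) := (μ.map fun s => s.2.2) ⊗ₘ ρ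
  calc 1 + ENNReal.ofReal (Real.log 2) * functionalInformation P
      = ∫⁻ y, (∫⁻ l, P.fst {x | ENNReal.ofReal l ≤ r x y} *
          (1 + nats (P.fst {x | ENNReal.ofReal l ≤ r x y})) ∂lam) ∂P.snd := by
        rw [ofReal_log_two_mul_functionalInformation hr hrM hM hP]
        simp only [mul_add, mul_one]
        rw [show (1 : ℝ≥0∞) = ∫⁻ y, 1 ∂P.snd by simp, ← lintegral_add_left measurable_const]
        apply lintegral_congr_ae
        filter_upwards [lintegral_density_ae_eq_one hr hrM hM hP] with y hy
        have hry : Measurable fun x => r x y := hr.comp (measurable_id.prodMk measurable_const)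
        rw [lintegral_add_left (hwy y), lintegral_measure_ofReal_le hry, hy]
    _ = ∫⁻ q, P.fst {x | ENNReal.ofReal q.2 ≤ r x q.1} *
          (1 + nats (P.fst {x | ENNReal.ofReal q.2 ≤ r x q.1})) ∂(P.snd.prod lam) := by
        rw [lintegral_prod _ (by fun_prop)]
    _ = ∫⁻ q, (∫⁻ t, min (ENNReal.ofReal t) (P.fst {x | ENNReal.ofReal q.2 ≤ r x q.1}) /
          ENNReal.ofReal t ∂tau) ∂(P.snd.prod lam) := by
        congr 1 with q
        exact (lintegral_min_div prob_le_one).symm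
    _ = ∫⁻ t, (∫⁻ q, min (ENNReal.ofReal t) (P.fst {x | ENNReal.ofReal q.2 ≤ r x q.1}) /
          ENNReal.ofReal t ∂(P.snd.prod lam)) ∂tau := by
        rw [lintegral_lintegral_swap]
        have : Measurable fun a : (𝒴 × ℝ) × ℝ => P.fst {x | ENNReal.ofReal a.1.2 ≤ r x a.1.1} :=
          hw.comp measurable_fst
        refine Measurable.aemeasurable ?_
        simp only [Function.uncurry_def]
        fun_prop
    _ ≤ ∫⁻ t, (∫⁻ q, min 1 (ENNReal.ofReal t / ρ q.1 {q.2}) / ENNReal.ofReal t ∂κ) ∂tau := by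
        apply setLIntegral_mono' measurableSet_Ioo
        intro t ht
        simp only [div_eq_mul_inv _ (ENNReal.ofReal t)]
        have hw' := (measurable_const (a := ENNReal.ofReal t)).min hw
        have hp' : Measurable fun q : 𝒵 × 𝒴 => min 1 (ENNReal.ofReal t / ρ q.1 {q.2}) :=
          measurable_const.min (measurable_const.div hp)
        rw [lintegral_mul_const _ hw', lintegral_mul_const _ hp', lintegral_prod _ hw'.aemeasurable,
          Measure.lintegral_compProd hp']
        gcongr
        exact h.lintegral_min_le hr hP (by simpa using ht.1)
    _ = ∫⁻ q, (∫⁻ t, min 1 (ENNReal.ofReal t / ρ q.1 {q.2}) / ENNReal.ofReal t ∂tau) ∂κ := by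
        rw [lintegral_lintegral_swap]
        have ht : Measurable fun a : ℝ × (𝒵 × 𝒴) => ENNReal.ofReal a.1 := by fun_prop
        exact ((measurable_const.min (ht.div (hp.comp measurable_snd))).div ht).aemeasurable
    _ = ∫⁻ q, (1 + nats (ρ q.1 {q.2})) ∂κ := by
        congr 1 with q
        exact lintegral_min_one_div prob_le_one
    _ = 1 + ENNReal.ofReal (Real.log 2) * condEntropy (fun t => t.2.1) (fun t => t.2.2) μ := by
        have : IsProbabilityMeasure (μ.map fun s => s.2.2) :=
          Measure.isProbabilityMeasure_map (by fun_prop)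
        have hnp : Measurable fun q : 𝒵 × 𝒴 => nats (ρ q.1 {q.2}) := hn.comp hp
        rw [lintegral_add_left measurable_const, Measure.lintegral_compProd hnp,
          condEntropy, ← lintegral_const_mul' _ _ ENNReal.ofReal_ne_top]
        simp only [lintegral_const, measure_univ, mul_one, entropy,
          ← lintegral_const_mul' _ _ ENNReal.ofReal_ne_top, ofReal_log_two_mul_surprisal]
        rfl

end Independent

/-! ### Codes as common randomness -/

theorem condEntropy_map {Ω : Type*} {Ω' : Type*} {𝒴 : Type v} {𝒵 : Type w} [MeasurableSpace Ω]
    [MeasurableSpace Ω'] [MeasurableSpace 𝒴] [StandardBorelSpace 𝒴] [Nonempty 𝒴]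
    [MeasurableSpace 𝒵] {ν : Measure Ω'} [IsFiniteMeasure ν] {φ : Ω' → Ω} (hφ : Measurable φ)
    {Y : Ω → 𝒴} (hY : Measurable Y) {Z : Ω → 𝒵} (hZ : Measurable Z) :
    condEntropy Y Z (ν.map φ) = condEntropy (Y ∘ φ) (Z ∘ φ) ν := by
  unfold condEntropy
  have h := condDistrib_map (ν := ν) (f := φ) (X := Z) (Y := Y) hZ.aemeasurable hY.aemeasurable
    hφ.aemeasurable
  rw [Measure.map_map hZ hφ]
  apply lintegral_congr_ae
  filter_upwards [h] with z hz
  rw [hz]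

section Code
variable {𝒳 : Type u} {𝒴 : Type v} {𝒵 : Type w} [MeasurableSpace 𝒳] [MeasurableSpace 𝒴]
  [MeasurableSpace 𝒵]

theorem StochasticCode.measurable_output {W : Kernel 𝒳 𝒴} (C : StochasticCode W 𝒵) :
    Measurable fun p : 𝒳 × 𝒵 => C.dec (C.enc p.1 p.2) p.2 := by
  intro s hs
  -- There are countably many codewords, so measurability can be checked on each event of a fixed
  -- codeword.
  have : (fun p : 𝒳 × 𝒵 => C.dec (C.enc p.1 p.2) p.2) ⁻¹' s =
      ⋃ l, {p : 𝒳 × 𝒵 | C.enc p.1 p.2 = l} ∩ {p | C.dec l p.2 ∈ s} := by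
    ext p
    simp
  rw [this]
  exact MeasurableSet.iUnion fun l =>
    (C.measurableSet_enc l).inter ((C.measurable_dec l).comp measurable_snd hs)

theorem StochasticCode.exists_isCommonRandomness [StandardBorelSpace 𝒴] [Nonempty 𝒴]
    {W : Kernel 𝒳 𝒴} [IsSFiniteKernel W] (C : StochasticCode W 𝒵) (PX : Measure 𝒳)
    [IsProbabilityMeasure PX] :
    ∃ (μ : Measure (𝒳 × 𝒴 × 𝒵)) (_ : IsProbabilityMeasure μ), IsCommonRandomness (PX ⊗ₘ W) μ ∧
      C.rate PX = condEntropy (fun t => t.2.1) (fun t => t.2.2) μ := by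
  have hf := C.measurable_output
  have hφ : Measurable fun p : 𝒳 × 𝒵 => (p.1, C.dec (C.enc p.1 p.2) p.2, p.2) := by fun_prop
  refine ⟨(PX.prod C.law).map fun p => (p.1, C.dec (C.enc p.1 p.2) p.2, p.2),
    Measure.isProbabilityMeasure_map hφ.aemeasurable, ⟨?_, ?_⟩, ?_⟩
  · rw [Measure.map_map (by fun_prop) hφ]
    ext s hs
    rw [Measure.map_apply (by fun_prop) hs, Measure.compProd_apply hs,
      Measure.prod_apply (hs.preimage (by fun_prop))]
    congr 1 with x
    have hfx : Measurable fun z => C.dec (C.enc x z) z := hf.comp measurable_prodMk_left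
    rw [← C.map_eq x, Measure.map_apply hfx (measurable_prodMk_left hs)]
    rfl
  · have := Measure.isProbabilityMeasure_map (μ := PX.prod C.law) hφ.aemeasurable
    rw [indepFun_iff_map_prod_eq_prod_map_map (by fun_prop) (by fun_prop),
      Measure.map_map (by fun_prop) hφ, Measure.map_map (by fun_prop) hφ,
      Measure.map_map (by fun_prop) hφ]
    change (PX.prod C.law).map id = ((PX.prod C.law).map Prod.fst).prod
      ((PX.prod C.law).map Prod.snd)
    rw [Measure.map_id, Measure.map_fst_prod, Measure.map_snd_prod]
    simp
  · rw [condEntropy_map hφ (by fun_prop) (by fun_prop)]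
    rfl

end Code

/-! ### Entropy of a discrete image, conditional laws on products, and geometric sums -/

/-- Applying `g` can only merge atoms, so each atom of the image is at least as heavy as the atom of
`K` it comes from and has smaller surprisal. -/
theorem ofReal_log_two_mul_entropy_map_le {𝒳 : Type u} {𝒴 : Type v} [MeasurableSpace 𝒳]
    [MeasurableSpace 𝒴] [MeasurableSingletonClass 𝒴] (PX : Measure 𝒳) [IsProbabilityMeasure PX]
    {K : 𝒳 → ℕ} (hK : Measurable K) (g : ℕ → 𝒴) :
    ENNReal.ofReal (Real.log 2) * entropy (PX.map (fun x => g (K x))) ≤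
      ∑' k, PX {x | K x = k} * nats (PX {x | K x = k}) := by
  have hg : Measurable g := measurable_of_countable g
  have hPK : ∀ k, PX.map K {k} = PX {x | K x = k} := fun k =>
    Measure.map_apply hK (measurableSet_singleton k)
  have := Measure.isProbabilityMeasure_map (μ := PX) hK.aemeasurable
  rw [show PX.map (fun x => g (K x)) = (PX.map K).map g from (Measure.map_map hg hK).symm, entropy,
    ← lintegral_const_mul' _ _ ENNReal.ofReal_ne_top]
  simp only [ofReal_log_two_mul_surprisal]
  refine (lintegral_map_le _ g).trans ?_
  rw [lintegral_countable']
  refine ENNReal.tsum_le_tsum fun k => ?_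
  rw [mul_comm, ← hPK]
  gcongr
  have hle : PX.map K {k} ≤ (PX.map K).map g {g k} := by
    rw [Measure.map_apply hg (measurableSet_singleton _)]
    exact measure_mono (by simp)
  have := Measure.isProbabilityMeasure_map (μ := PX.map K) hg.aemeasurable
  exact antitoneOn_nats prob_le_one prob_le_one hle

theorem condDistrib_snd_prod_ae_eq {𝒳 : Type u} {𝒴 : Type v} {𝒵 : Type w} [MeasurableSpace 𝒳]
    [MeasurableSpace 𝒴] [StandardBorelSpace 𝒴] [Nonempty 𝒴] [MeasurableSpace 𝒵]
    (μ : Measure 𝒳) [IsProbabilityMeasure μ] (ν : Measure 𝒵) [IsProbabilityMeasure ν]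
    {f : 𝒳 × 𝒵 → 𝒴} (hf : Measurable f) :
    ∀ᵐ z ∂ν, condDistrib f Prod.snd (μ.prod ν) z = μ.map (fun x => f (x, z)) := by
  have hfz : ∀ z, Measurable fun x => f (x, z) := fun z => hf.comp measurable_prodMk_right
  let κ : Kernel 𝒵 𝒴 := ⟨fun z => μ.map (fun x => f (x, z)), by
    refine Measure.measurable_of_measurable_coe _ fun s hs => ?_
    simp only [Measure.map_apply (hfz _) hs]
    exact measurable_measure_prodMk_right (hf hs)⟩
  have hκ : IsMarkovKernel κ := ⟨fun z => Measure.isProbabilityMeasure_map (hfz z).aemeasurable⟩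
  have hsnd : (μ.prod ν).map Prod.snd = ν := by simp [Measure.map_snd_prod]
  have h := condDistrib_ae_eq_of_measure_eq_compProd (μ := μ.prod ν) (Y := f) Prod.snd
    hf.aemeasurable (κ := κ) ?_
  · rwa [hsnd] at h
  · rw [hsnd]
    ext s hs
    rw [Measure.map_apply (by fun_prop) hs, Measure.compProd_apply hs,
      Measure.prod_apply_symm (hs.preimage (by fun_prop))]
    congr 1 with z
    exact (Measure.map_apply (hfz z) (measurable_prodMk_left hs)).symm

/-- The second alternative reflects the convention `sInf ∅ = 0`; it will correspond to the null
event that no proposal is accepted. -/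
theorem nat_sInf_eq_iff (S : Set ℕ) (k : ℕ) :
    sInf S = k ↔ (k ∈ S ∧ ∀ j < k, j ∉ S) ∨ (k = 0 ∧ ∀ j, j ∉ S) := by
  constructor
  · rintro rfl
    by_cases h : S.Nonempty
    · exact Or.inl ⟨Nat.sInf_mem h, fun j hj => Nat.notMem_of_lt_sInf hj⟩
    · rw [Set.not_nonempty_iff_eq_empty] at h
      subst h
      simp
  · rintro (⟨h1, h2⟩ | ⟨rfl, h⟩)
    · exact le_antisymm (Nat.sInf_le h1)
        (not_lt.1 fun h => h2 _ h (Nat.sInf_mem ⟨k, h1⟩))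
    · rw [Nat.sInf_eq_zero]
      exact Or.inr (Set.eq_empty_of_forall_notMem h)

theorem ofReal_geometric_mul_nats {s : ℝ} (hs0 : 0 < s) (hs1 : s < 1) (k : ℕ) :
    ENNReal.ofReal (1 - s) * ENNReal.ofReal s ^ k * nats (ENNReal.ofReal s ^ k) =
      ENNReal.ofReal ((1 - s) * -Real.log s * (k * s ^ k)) := by
  have h1 : 0 ≤ 1 - s := by linarith
  have h2 : 0 < s ^ k := pow_pos hs0 k
  rw [← ENNReal.ofReal_pow hs0.le, nats, if_neg (by simpa using h2), ENNReal.toReal_ofReal h2.le,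
    Real.log_pow, ← ENNReal.ofReal_mul h1, ← ENNReal.ofReal_mul (mul_nonneg h1 h2.le)]
  congr 1
  ring

/-- The left side is `-log s` times the mean `s / (1 - s)` of a geometric variable, and `-log s ≤ 1
/ s - 1` is the reciprocal of that mean. This is the source of the additive constant of one nat. -/
theorem geometric_entropy_le_one {s : ℝ} (hs0 : 0 < s) (hs1 : s < 1) :
    (1 - s) * -Real.log s * (s / (1 - s) ^ 2) ≤ 1 := by
  have h1 := Real.log_le_sub_one_of_pos (inv_pos.2 hs0)
  rw [Real.log_inv] at h1
  have h2 : 0 < 1 - s := by linarith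
  calc (1 - s) * -Real.log s * (s / (1 - s) ^ 2) ≤ (1 - s) * (s⁻¹ - 1) * (s / (1 - s) ^ 2) := by
        gcongr
    _ = 1 := by field_simp

theorem tsum_geometric_mul_nats_le {s : ℝ} (hs0 : 0 < s) (hs1 : s < 1) :
    ∑' k : ℕ, ENNReal.ofReal (1 - s) * ENNReal.ofReal s ^ k * nats (ENNReal.ofReal s ^ k) ≤ 1 := by
  have hlog : 0 ≤ -Real.log s := by linarith [Real.log_neg hs0 hs1]
  have h1 : 0 ≤ 1 - s := by linarith
  have hnn : ∀ k : ℕ, 0 ≤ (1 - s) * -Real.log s * (k * s ^ k) := fun k =>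
    mul_nonneg (mul_nonneg h1 hlog) (mul_nonneg k.cast_nonneg (pow_nonneg hs0.le k))
  have h : ‖s‖ < 1 := by rwa [Real.norm_eq_abs, abs_of_pos hs0]
  have hsum := (hasSum_coe_mul_geometric_of_norm_lt_one h).mul_left ((1 - s) * -Real.log s)
  rw [tsum_congr (ofReal_geometric_mul_nats hs0 hs1), ← ENNReal.ofReal_tsum_of_nonneg hnn
    hsum.summable, hsum.tsum_eq, ENNReal.ofReal_le_one]
  exact geometric_entropy_le_one hs0 hs1

/-! ### Rejection sampling with independent proposals -/

/-- The product of a function of the `k`-th variable and of indicators of the earlier variables in a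
sequence of independent identically distributed variables. -/
theorem lintegral_mul_prod_indicator_of_iIndepFun {E : Type*} {𝒵 : Type w} [MeasurableSpace E]
    [MeasurableSpace 𝒵] {law : Measure 𝒵} {V : ℕ → 𝒵 → E} (hV : ∀ k, Measurable (V k))
    (hind : iIndepFun V law) {lam : Measure E} (hlam : ∀ k, law.map (V k) = lam) {N : Set E}
    (hN : MeasurableSet N) {g : E → ℝ≥0∞} (hg : Measurable g) (k : ℕ) :
    ∫⁻ z, g (V k z) * ∏ j ∈ Finset.range k, N.indicator 1 (V j z) ∂law =
      (∫⁻ v, g v ∂lam) * lam N ^ k := by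
  have hφ : ∀ j, Measurable (if j = k then g else N.indicator 1) := fun j => by
    split_ifs
    exacts [hg, measurable_one.indicator hN]
  have h := lintegral_prod_eq_prod_lintegral_of_indepFun (Finset.range (k + 1)) _
    (hind.comp (fun j => if j = k then g else N.indicator 1) hφ) fun j => (hφ j).comp (hV j)
  simp only [Finset.prod_range_succ, Function.comp_apply, if_true] at h
  have e1 : ∀ z, ∏ j ∈ Finset.range k, (if j = k then g else N.indicator 1) (V j z) =
      ∏ j ∈ Finset.range k, N.indicator 1 (V j z) := fun z =>
    Finset.prod_congr rfl fun j hj => by rw [if_neg (Finset.mem_range.1 hj).ne]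
  have e2 : ∀ j ∈ Finset.range k, ∫⁻ z, (if j = k then g else N.indicator 1) (V j z) ∂law =
      lam N := fun j hj => by
    rw [if_neg (Finset.mem_range.1 hj).ne, ← lintegral_map (measurable_one.indicator hN) (hV j),
      hlam, lintegral_indicator_one hN]
  rw [Finset.prod_congr rfl e2, Finset.prod_const, Finset.card_range,
    ← lintegral_map hg (hV k), hlam, mul_comm] at h
  rw [← h]
  congr 1 with z
  rw [e1, mul_comm]

/-- Rejection sampling accepts the proposal `v = (y, u)` on input `x` if `u ≤ r x y`. -/
def accepts {𝒳 : Type u} {𝒴 : Type v} (r : 𝒳 → 𝒴 → ℝ≥0∞) (x : 𝒳) (v : 𝒴 × ℝ) : Prop :=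
  ENNReal.ofReal v.2 ≤ r x v.1

/-- The proposal `k` is the first one that is accepted. -/
def acceptsFirst {𝒳 : Type u} {𝒴 : Type v} {𝒵 : Type w} (r : 𝒳 → 𝒴 → ℝ≥0∞) (V : ℕ → 𝒵 → 𝒴 × ℝ)
    (k : ℕ) (x : 𝒳) (z : 𝒵) : Prop :=
  accepts r x (V k z) ∧ ∀ j < k, ¬ accepts r x (V j z)

/-- The index of the first accepted proposal, and `0` if there is none. -/
noncomputable def acceptedIndex {𝒳 : Type u} {𝒴 : Type v} {𝒵 : Type w} (r : 𝒳 → 𝒴 → ℝ≥0∞)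
    (V : ℕ → 𝒵 → 𝒴 × ℝ) (x : 𝒳) (z : 𝒵) : ℕ :=
  sInf {k | accepts r x (V k z)}

/-- The uniform law on `(0, b]`. -/
noncomputable def uniformLaw (b : ℝ≥0∞) : Measure ℝ :=
  b⁻¹ • (volume.restrict (Set.Ioi 0)).restrict {u | ENNReal.ofReal u ≤ b}

/-- The law of a proposal: a pair of independent variables with law `ν` and with the uniform law on
`(0, b]`. -/
noncomputable def proposalLaw {𝒴 : Type v} [MeasurableSpace 𝒴] (ν : Measure 𝒴) (b : ℝ≥0∞) :
    Measure (𝒴 × ℝ) :=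
  ν.prod (uniformLaw b)

theorem uniformLaw_ofReal_le {b c : ℝ≥0∞} (hc : c ≤ b) :
    uniformLaw b {u | ENNReal.ofReal u ≤ c} = b⁻¹ * c := by
  have h : {u : ℝ | ENNReal.ofReal u ≤ c} ∩ {u | ENNReal.ofReal u ≤ b} =
      {u | ENNReal.ofReal u ≤ c} := Set.inter_eq_left.2 fun u hu => le_trans hu hc
  rw [uniformLaw, Measure.smul_apply,
    Measure.restrict_apply (measurableSet_le (by fun_prop) measurable_const), h,
    volume_restrict_Ioi_ofReal_le, smul_eq_mul]

theorem isProbabilityMeasure_uniformLaw {b : ℝ≥0∞} (hb0 : b ≠ 0) (hb : b ≠ ∞) :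
    IsProbabilityMeasure (uniformLaw b) := by
  constructor
  rw [uniformLaw, Measure.smul_apply, Measure.restrict_apply MeasurableSet.univ, Set.univ_inter,
    volume_restrict_Ioi_ofReal_le, smul_eq_mul, ENNReal.inv_mul_cancel hb0 hb]

theorem acceptedIndex_eq_iff {𝒳 : Type u} {𝒴 : Type v} {𝒵 : Type w} {r : 𝒳 → 𝒴 → ℝ≥0∞}
    {V : ℕ → 𝒵 → 𝒴 × ℝ} {x : 𝒳} {z : 𝒵} {k : ℕ} :
    acceptedIndex r V x z = k ↔
      acceptsFirst r V k x z ∨ (k = 0 ∧ ∀ j, ¬ accepts r x (V j z)) :=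
  nat_sInf_eq_iff _ _

section Proposal
variable {𝒳 : Type u} {𝒴 : Type v} [MeasurableSpace 𝒳] [MeasurableSpace 𝒴]
  {r : 𝒳 → 𝒴 → ℝ≥0∞}

theorem measurableSet_accepts (hr : Measurable (Function.uncurry r)) :
    MeasurableSet {p : 𝒳 × 𝒴 × ℝ | accepts r p.1 p.2} :=
  measurableSet_le (by fun_prop) (hr.comp (f := fun p : 𝒳 × 𝒴 × ℝ => (p.1, p.2.1)) (by fun_prop))

variable {𝒵 : Type w} [MeasurableSpace 𝒵] {V : ℕ → 𝒵 → 𝒴 × ℝ}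

theorem measurableSet_accepts_comp (hr : Measurable (Function.uncurry r)) (hV : ∀ k, Measurable (V k))
    (k : ℕ) : MeasurableSet {p : 𝒳 × 𝒵 | accepts r p.1 (V k p.2)} :=
  (measurableSet_accepts hr).preimage (f := fun p : 𝒳 × 𝒵 => (p.1, V k p.2))
    (measurable_fst.prodMk ((hV k).comp measurable_snd))

theorem measurableSet_acceptsFirst (hr : Measurable (Function.uncurry r))
    (hV : ∀ k, Measurable (V k)) (k : ℕ) :
    MeasurableSet {p : 𝒳 × 𝒵 | acceptsFirst r V k p.1 p.2} := by
  have : {p : 𝒳 × 𝒵 | acceptsFirst r V k p.1 p.2} = {p : 𝒳 × 𝒵 | accepts r p.1 (V k p.2)} ∩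
      ⋂ j, ⋂ (_ : j < k), {p : 𝒳 × 𝒵 | accepts r p.1 (V j p.2)}ᶜ := by
    ext p
    simp [acceptsFirst]
  rw [this]
  exact (measurableSet_accepts_comp hr hV k).inter (MeasurableSet.iInter fun j =>
    MeasurableSet.iInter fun _ => (measurableSet_accepts_comp hr hV j).compl)

theorem measurableSet_forall_not_accepts (hr : Measurable (Function.uncurry r))
    (hV : ∀ k, Measurable (V k)) :
    MeasurableSet {p : 𝒳 × 𝒵 | ∀ j, ¬ accepts r p.1 (V j p.2)} := by
  have : {p : 𝒳 × 𝒵 | ∀ j, ¬ accepts r p.1 (V j p.2)} =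
      ⋂ j, {p : 𝒳 × 𝒵 | accepts r p.1 (V j p.2)}ᶜ := by
    ext p
    simp
  rw [this]
  exact MeasurableSet.iInter fun j => (measurableSet_accepts_comp hr hV j).compl

theorem measurable_acceptedIndex (hr : Measurable (Function.uncurry r))
    (hV : ∀ k, Measurable (V k)) :
    Measurable fun p : 𝒳 × 𝒵 => acceptedIndex r V p.1 p.2 := by
  refine measurable_to_countable' fun k => ?_
  have : (fun p : 𝒳 × 𝒵 => acceptedIndex r V p.1 p.2) ⁻¹' {k} =
      {p : 𝒳 × 𝒵 | acceptsFirst r V k p.1 p.2} ∪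
        ({_p : 𝒳 × 𝒵 | k = 0} ∩ {p : 𝒳 × 𝒵 | ∀ j, ¬ accepts r p.1 (V j p.2)}) := by
    ext p
    exact acceptedIndex_eq_iff
  rw [this]
  exact (measurableSet_acceptsFirst hr hV k).union
    ((MeasurableSet.const _).inter (measurableSet_forall_not_accepts hr hV))

variable {ν : Measure 𝒴} {b : ℝ≥0∞}

theorem isProbabilityMeasure_proposalLaw [IsProbabilityMeasure ν] (hb0 : b ≠ 0) (hb : b ≠ ∞) :
    IsProbabilityMeasure (proposalLaw ν b) := by
  have := isProbabilityMeasure_uniformLaw hb0 hb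
  unfold proposalLaw
  infer_instance

/-- Given `y`, the uniform height lies below `r x y ≤ b` with probability `r x y / b`. Taking all of
`𝒴` for `S` makes the acceptance probability `1 / b` whatever the input. -/
theorem proposalLaw_accepts_inter (hr : Measurable (Function.uncurry r)) (hrb : ∀ x y, r x y ≤ b)
    (hb0 : b ≠ 0) (hb : b ≠ ∞) (x : 𝒳) {S : Set 𝒴} (hS : MeasurableSet S) :
    proposalLaw ν b {v | accepts r x v ∧ v.1 ∈ S} = b⁻¹ * ν.withDensity (r x) S := by
  have hm : MeasurableSet {v : 𝒴 × ℝ | accepts r x v ∧ v.1 ∈ S} :=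
    (measurable_prodMk_left (measurableSet_accepts hr)).inter (measurable_fst hS)
  have hrx : Measurable (r x) := hr.comp measurable_prodMk_left
  have := isProbabilityMeasure_uniformLaw hb0 hb
  rw [proposalLaw, Measure.prod_apply hm, withDensity_apply _ hS, ← lintegral_indicator hS,
    ← lintegral_const_mul _ (hrx.indicator hS)]
  congr 1 with y
  by_cases hy : y ∈ S
  · rw [Set.indicator_of_mem hy, ← uniformLaw_ofReal_le (hrb x y)]
    congr 1
    ext u
    simp [accepts, hy]
  · have : Prod.mk y ⁻¹' {v : 𝒴 × ℝ | accepts r x v ∧ v.1 ∈ S} = ∅ := by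
      ext u
      simp [hy]
    rw [this, Set.indicator_of_notMem hy, measure_empty, mul_zero]

theorem proposalLaw_accepts (hr : Measurable (Function.uncurry r)) (hrb : ∀ x y, r x y ≤ b)
    (hb0 : b ≠ 0) (hb : b ≠ ∞) (x : 𝒳) [IsProbabilityMeasure (ν.withDensity (r x))] :
    proposalLaw ν b {v | accepts r x v} = b⁻¹ := by
  have h := proposalLaw_accepts_inter (ν := ν) hr hrb hb0 hb x MeasurableSet.univ
  simpa using h

/-- Dropping the truncation `u ≤ b` replaces the uniform law by Lebesgue measure over all positive
levels, as in the functional information. -/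
theorem lintegral_proposalLaw_le {g : 𝒴 × ℝ → ℝ≥0∞} (hg : Measurable g) (hb0 : b ≠ 0) (hb : b ≠ ∞) :
    ∫⁻ v, g v ∂(proposalLaw ν b) ≤
      b⁻¹ * ∫⁻ y, (∫⁻ u in Set.Ioi (0 : ℝ), g (y, u)) ∂ν := by
  have hb' := ENNReal.inv_ne_top.2 hb0
  have := isProbabilityMeasure_uniformLaw hb0 hb
  rw [proposalLaw, lintegral_prod _ hg.aemeasurable, ← lintegral_const_mul' _ _ hb']
  refine lintegral_mono fun y => ?_
  rw [uniformLaw, lintegral_smul_measure, smul_eq_mul]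
  exact mul_le_mul_right (setLIntegral_le_lintegral _ _) _

end Proposal

section Rejection
variable {𝒳 : Type u} {𝒴 : Type v} [MeasurableSpace 𝒳] [MeasurableSpace 𝒴]
  {r : 𝒳 → 𝒴 → ℝ≥0∞} {𝒵 : Type w} {V : ℕ → 𝒵 → 𝒴 × ℝ}

omit [MeasurableSpace 𝒳] [MeasurableSpace 𝒴] in
theorem prod_indicator_not_accepts (x : 𝒳) (z : 𝒵) (k : ℕ) :
    ∏ j ∈ Finset.range k, {v | ¬ accepts r x v}.indicator (1 : 𝒴 × ℝ → ℝ≥0∞) (V j z) =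
      {z | ∀ j < k, ¬ accepts r x (V j z)}.indicator 1 z := by
  classical
  simp only [Set.indicator_apply, Pi.one_apply, Finset.prod_ite_zero, Finset.prod_const_one,
    Set.mem_ofPred_eq, Finset.mem_range]

omit [MeasurableSpace 𝒳] [MeasurableSpace 𝒴] in
theorem indicator_acceptsFirst (h : 𝒴 × ℝ → ℝ≥0∞) (x : 𝒳) (z : 𝒵) (k : ℕ) :
    {z | acceptsFirst r V k x z}.indicator (fun z => h (V k z)) z =
      {v | accepts r x v}.indicator h (V k z) *
        ∏ j ∈ Finset.range k, {v | ¬ accepts r x v}.indicator 1 (V j z) := by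
  classical
  rw [prod_indicator_not_accepts]
  simp only [Set.indicator_apply, Set.mem_ofPred_eq, Pi.one_apply, acceptsFirst]
  by_cases h1 : accepts r x (V k z) <;> by_cases h2 : ∀ j < k, ¬ accepts r x (V j z) <;>
    simp [h1, h2]

variable [MeasurableSpace 𝒵] {ν : Measure 𝒴} [IsProbabilityMeasure ν] {b : ℝ≥0∞}
  {law : Measure 𝒵}

theorem proposalLaw_not_accepts (hr : Measurable (Function.uncurry r)) (hrb : ∀ x y, r x y ≤ b)
    (hb0 : b ≠ 0) (hb : b ≠ ∞) (x : 𝒳) [IsProbabilityMeasure (ν.withDensity (r x))] :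
    proposalLaw ν b {v | ¬ accepts r x v} = 1 - b⁻¹ := by
  have := isProbabilityMeasure_proposalLaw (ν := ν) hb0 hb
  rw [← proposalLaw_accepts (ν := ν) hr hrb hb0 hb x]
  exact prob_compl_eq_one_sub (measurable_prodMk_left (measurableSet_accepts hr))

theorem lintegral_acceptsFirst (hr : Measurable (Function.uncurry r)) (hrb : ∀ x y, r x y ≤ b)
    (hb0 : b ≠ 0) (hb : b ≠ ∞) (hV : ∀ k, Measurable (V k)) (hind : iIndepFun V law)
    (hlam : ∀ k, law.map (V k) = proposalLaw ν b) (x : 𝒳)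
    [IsProbabilityMeasure (ν.withDensity (r x))] {h : 𝒴 × ℝ → ℝ≥0∞} (hh : Measurable h) (k : ℕ) :
    ∫⁻ z, {z | acceptsFirst r V k x z}.indicator (fun z => h (V k z)) z ∂law =
      (∫⁻ v in {v | accepts r x v}, h v ∂(proposalLaw ν b)) * (1 - b⁻¹) ^ k := by
  have hA : MeasurableSet {v | accepts r x v} :=
    measurable_prodMk_left (measurableSet_accepts hr)
  simp only [indicator_acceptsFirst]
  rw [lintegral_mul_prod_indicator_of_iIndepFun hV hind hlam (N := {v | ¬ accepts r x v}) hA.compl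
    (hh.indicator hA), lintegral_indicator hA, proposalLaw_not_accepts hr hrb hb0 hb]

/-- On every input, some proposal is accepted almost surely. -/
theorem measure_forall_not_accepts (hr : Measurable (Function.uncurry r)) (hrb : ∀ x y, r x y ≤ b)
    (hb0 : b ≠ 0) (hb : b ≠ ∞) (hV : ∀ k, Measurable (V k)) (hind : iIndepFun V law)
    (hlam : ∀ k, law.map (V k) = proposalLaw ν b) (x : 𝒳)
    [IsProbabilityMeasure (ν.withDensity (r x))] :
    law {z | ∀ j, ¬ accepts r x (V j z)} = 0 := by
  have := isProbabilityMeasure_proposalLaw (ν := ν) hb0 hb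
  have hA : MeasurableSet {v | accepts r x v} :=
    measurable_prodMk_left (measurableSet_accepts hr)
  have hq : 1 - b⁻¹ < 1 := ENNReal.sub_lt_self ENNReal.one_ne_top one_ne_zero
    (ENNReal.inv_ne_zero.2 hb)
  refine le_antisymm (ge_of_tendsto' (ENNReal.tendsto_pow_atTop_nhds_zero_of_lt_one hq)
    fun k => ?_) zero_le
  have h := lintegral_mul_prod_indicator_of_iIndepFun hV hind hlam (N := {v | ¬ accepts r x v})
    hA.compl (measurable_const (a := (1 : ℝ≥0∞))) k
  have hm : MeasurableSet {z | ∀ j < k, ¬ accepts r x (V j z)} := by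
    have : {z | ∀ j < k, ¬ accepts r x (V j z)} =
        ⋂ j, ⋂ (_ : j < k), V j ⁻¹' {v | accepts r x v}ᶜ := by
      ext z
      simp
    rw [this]
    exact MeasurableSet.iInter fun j => MeasurableSet.iInter fun _ => hV j hA.compl
  simp only [prod_indicator_not_accepts, one_mul, lintegral_one, measure_univ] at h
  rw [lintegral_indicator_one hm, proposalLaw_not_accepts hr hrb hb0 hb] at h
  rw [← h]
  exact measure_mono fun z hz j _ => hz j

/-- Rejection sampling produces the target law. -/
theorem map_accepted_eq (hr : Measurable (Function.uncurry r)) (hrb : ∀ x y, r x y ≤ b)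
    [IsProbabilityMeasure law] (hb1 : 1 ≤ b) (hb : b ≠ ∞) (hV : ∀ k, Measurable (V k))
    (hind : iIndepFun V law) (hlam : ∀ k, law.map (V k) = proposalLaw ν b) (x : 𝒳)
    [IsProbabilityMeasure (ν.withDensity (r x))]
    (hm : Measurable fun z => (V (acceptedIndex r V x z) z).1) :
    law.map (fun z => (V (acceptedIndex r V x z) z).1) = ν.withDensity (r x) := by
  have hb0 : b ≠ 0 := (one_pos.trans_le hb1).ne'
  have := Measure.isProbabilityMeasure_map (μ := law) hm.aemeasurable
  symm
  -- Two probability measures with one below the other coincide, so a lower bound over the disjoint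
  -- events of first acceptance suffices and the default index needs no treatment here.
  refine Measure.eq_of_le_of_isProbabilityMeasure (Measure.le_iff.2 fun S hS => ?_)
  have hF : ∀ k, MeasurableSet ({z | acceptsFirst r V k x z} ∩ {z | (V k z).1 ∈ S}) := fun k =>
    (measurable_prodMk_left (measurableSet_acceptsFirst hr hV k)).inter
      ((measurable_fst.comp (hV k)) hS)
  have hFk : ∀ k, law ({z | acceptsFirst r V k x z} ∩ {z | (V k z).1 ∈ S}) =
      b⁻¹ * ν.withDensity (r x) S * (1 - b⁻¹) ^ k := by
    intro k
    have hS' : MeasurableSet {v : 𝒴 × ℝ | v.1 ∈ S} := measurable_fst hS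
    have h := lintegral_acceptsFirst hr hrb hb0 hb hV hind hlam x
      (measurable_one.indicator hS') k
    simp only [setLIntegral_indicator hS', Pi.one_apply, setLIntegral_one, Set.inter_comm] at h
    rw [← proposalLaw_accepts_inter (ν := ν) hr hrb hb0 hb x hS]
    refine Eq.trans ?_ h
    rw [← lintegral_indicator_one (hF k)]
    congr 1 with z
    by_cases h1 : acceptsFirst r V k x z <;> by_cases h2 : (V k z).1 ∈ S <;>
      simp [Set.indicator, h1, h2]
  have hdisj : Pairwise (Function.onFun Disjoint
      fun k => {z | acceptsFirst r V k x z} ∩ {z | (V k z).1 ∈ S}) := by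
    intro i j hij
    refine Set.disjoint_left.2 fun z hi hj => hij ?_
    rw [← acceptedIndex_eq_iff.2 (Or.inl hi.1), acceptedIndex_eq_iff.2 (Or.inl hj.1)]
  calc ν.withDensity (r x) S = ∑' k, b⁻¹ * ν.withDensity (r x) S * (1 - b⁻¹) ^ k := by
        rw [ENNReal.tsum_mul_left, ENNReal.tsum_geometric,
          ENNReal.sub_sub_cancel ENNReal.one_ne_top (ENNReal.inv_le_one.2 hb1), inv_inv, mul_right_comm,
          ENNReal.inv_mul_cancel hb0 hb, one_mul]
    _ = law (⋃ k, {z | acceptsFirst r V k x z} ∩ {z | (V k z).1 ∈ S}) := by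
        rw [measure_iUnion hdisj hF]
        simp only [hFk]
    _ ≤ law.map (fun z => (V (acceptedIndex r V x z) z).1) S := by
        rw [Measure.map_apply hm hS]
        apply measure_mono
        refine Set.iUnion_subset fun k z hz => ?_
        rw [Set.mem_preimage, acceptedIndex_eq_iff.2 (Or.inl hz.1)]
        exact hz.2

theorem measurable_accepted (hr : Measurable (Function.uncurry r)) (hV : ∀ k, Measurable (V k)) :
    Measurable fun p : 𝒳 × 𝒵 => (V (acceptedIndex r V p.1 p.2) p.2).1 :=
  measurable_fst.comp (measurable_from_prod_countable_right (f := fun q : ℕ × 𝒵 => V q.1 q.2) hV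
    |>.comp ((measurable_acceptedIndex hr hV).prodMk measurable_snd))

/-- The rejection sampling code: the encoder sends the index of the first accepted proposal in
unary. -/
noncomputable def rejectionCode (W : Kernel 𝒳 𝒴) [IsProbabilityMeasure law]
    (hr : Measurable (Function.uncurry r))
    (hrb : ∀ x y, r x y ≤ b) (hb1 : 1 ≤ b) (hb : b ≠ ∞) (hV : ∀ k, Measurable (V k))
    (hind : iIndepFun V law) (hlam : ∀ k, law.map (V k) = proposalLaw ν b) [IsMarkovKernel W]
    (hW : ∀ x, W x = ν.withDensity (r x)) : StochasticCode W 𝒵 where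
  law := law
  isProbabilityMeasure_law := inferInstance
  -- The rate is `H(Y | Z)` and not a codeword length, so any injective encoding of the index would
  -- do.
  enc x z := List.replicate (acceptedIndex r V x z) true
  dec s z := (V s.length z).1
  measurableSet_enc s :=
    measurable_acceptedIndex hr hV (MeasurableSet.of_discrete (s := {k | List.replicate k true = s}))
  measurable_dec s := measurable_fst.comp (hV s.length)
  map_eq x := by
    have : IsProbabilityMeasure (ν.withDensity (r x)) := hW x ▸ inferInstance
    simp only [List.length_replicate]
    rw [hW, map_accepted_eq hr hrb hb1 hb hV hind hlam x
      ((measurable_accepted hr hV).comp measurable_prodMk_left)]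

variable {PX : Measure 𝒳} [IsProbabilityMeasure PX]

/-- After exchanging `x` with the randomness, the earlier rejections contribute `(1 - b⁻¹) ^ k` for
every `x`. This factor comes out of the integral, leaving a single proposal. -/
theorem lintegral_measure_acceptsFirst_mul [IsProbabilityMeasure law] (hr : Measurable (Function.uncurry r))
    (hrb : ∀ x y, r x y ≤ b)
    (hb0 : b ≠ 0) (hb : b ≠ ∞) (hV : ∀ k, Measurable (V k)) (hind : iIndepFun V law)
    (hlam : ∀ k, law.map (V k) = proposalLaw ν b)
    (hW : ∀ x, IsProbabilityMeasure (ν.withDensity (r x))) {h : 𝒴 × ℝ → ℝ≥0∞} (hh : Measurable h)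
    (k : ℕ) :
    ∫⁻ z, PX {x | acceptsFirst r V k x z} * h (V k z) ∂law =
      (∫⁻ v, PX {x | accepts r x v} * h v ∂(proposalLaw ν b)) * (1 - b⁻¹) ^ k := by
  have := isProbabilityMeasure_proposalLaw (ν := ν) hb0 hb
  have hF := measurableSet_acceptsFirst (𝒳 := 𝒳) hr hV k
  have hA := measurableSet_accepts (𝒳 := 𝒳) hr
  calc ∫⁻ z, PX {x | acceptsFirst r V k x z} * h (V k z) ∂law
      = ∫⁻ z, ∫⁻ x, {p : 𝒳 × 𝒵 | acceptsFirst r V k p.1 p.2}.indicator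
          (fun p => h (V k p.2)) (x, z) ∂PX ∂law := by
        congr 1 with z
        have hFz : MeasurableSet {x | acceptsFirst r V k x z} := measurable_prodMk_right hF
        rw [mul_comm, ← lintegral_indicator_const hFz]
        rfl
    _ = ∫⁻ x, ∫⁻ z, {p : 𝒳 × 𝒵 | acceptsFirst r V k p.1 p.2}.indicator
          (fun p => h (V k p.2)) (x, z) ∂law ∂PX := by
        rw [lintegral_lintegral_swap]
        exact (((hh.comp ((hV k).comp measurable_snd)).indicator hF).comp
          measurable_swap).aemeasurable
    _ = ∫⁻ x, (∫⁻ v, {p : 𝒳 × 𝒴 × ℝ | accepts r p.1 p.2}.indicator (fun p => h p.2) (x, v)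
          ∂(proposalLaw ν b)) * (1 - b⁻¹) ^ k ∂PX := by
        congr 1 with x
        refine (lintegral_acceptsFirst hr hrb hb0 hb hV hind hlam x hh k).trans ?_
        have hAx : MeasurableSet {v | accepts r x v} := measurable_prodMk_left hA
        rw [← lintegral_indicator hAx]
        rfl
    _ = (∫⁻ x, ∫⁻ v, {p : 𝒳 × 𝒴 × ℝ | accepts r p.1 p.2}.indicator (fun p => h p.2) (x, v)
          ∂(proposalLaw ν b) ∂PX) * (1 - b⁻¹) ^ k :=
        lintegral_mul_const' _ _ (ENNReal.pow_ne_top (ENNReal.sub_ne_top ENNReal.one_ne_top))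
    _ = _ := by
        congr 1
        rw [lintegral_lintegral_swap]
        swap
        · exact ((hh.comp measurable_snd).indicator hA).aemeasurable
        congr 1 with v
        have hAv : MeasurableSet {x | accepts r x v} := measurable_prodMk_right hA
        rw [mul_comm, ← lintegral_indicator_const hAv]
        rfl

end Rejection

/-! ### The rate of the rejection sampling code -/

theorem tsum_inv_mul_geometric_mul_nats_le {b : ℝ≥0∞} (hb1 : 1 < b) (hb : b ≠ ∞) :
    ∑' k : ℕ, b⁻¹ * (1 - b⁻¹) ^ k * nats ((1 - b⁻¹) ^ k) ≤ 1 := by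
  obtain ⟨t, rfl⟩ : ∃ t : ℝ, b = ENNReal.ofReal t := ⟨_, (ENNReal.ofReal_toReal hb).symm⟩
  have ht : 1 < t := by simpa using hb1
  have ht0 : 0 < t := by linarith
  have hti : t⁻¹ < 1 := inv_lt_one_of_one_lt₀ ht
  have h := tsum_geometric_mul_nats_le (s := 1 - t⁻¹) (by linarith) (by simpa using ht0)
  rwa [sub_sub_cancel, ENNReal.ofReal_sub _ (by positivity), ENNReal.ofReal_one,
    ENNReal.ofReal_inv_of_pos ht0] at h

section Rate
variable {𝒳 : Type u} {𝒴 : Type v} [MeasurableSpace 𝒳] [MeasurableSpace 𝒴]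
  {r : 𝒳 → 𝒴 → ℝ≥0∞} {𝒵 : Type w} {V : ℕ → 𝒵 → 𝒴 × ℝ}
  [MeasurableSpace 𝒵] {ν : Measure 𝒴} [IsProbabilityMeasure ν] {b : ℝ≥0∞}
  {law : Measure 𝒵} [IsProbabilityMeasure law] {PX : Measure 𝒳} [IsProbabilityMeasure PX]

theorem lintegral_measure_accepts (hr : Measurable (Function.uncurry r))
    (hrb : ∀ x y, r x y ≤ b) (hb0 : b ≠ 0) (hb : b ≠ ∞)
    (hW : ∀ x, IsProbabilityMeasure (ν.withDensity (r x))) :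
    ∫⁻ v, PX {x | accepts r x v} ∂(proposalLaw ν b) = b⁻¹ := by
  have := isProbabilityMeasure_proposalLaw (ν := ν) hb0 hb
  have hA := measurableSet_accepts (𝒳 := 𝒳) hr
  have h := (Measure.prod_apply_symm (μ := PX) (ν := proposalLaw ν b) hA).symm.trans
    (Measure.prod_apply hA)
  refine h.trans ?_
  rw [show b⁻¹ = ∫⁻ _, b⁻¹ ∂PX by simp]
  congr 1 with x
  exact proposalLaw_accepts hr hrb hb0 hb x

theorem measurable_measure_accepts (hr : Measurable (Function.uncurry r)) :
    Measurable fun v : 𝒴 × ℝ => PX {x | accepts r x v} :=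
  measurable_measure_prodMk_right (measurableSet_accepts hr)

theorem measurable_measure_acceptsFirst (hr : Measurable (Function.uncurry r))
    (hV : ∀ k, Measurable (V k)) (k : ℕ) :
    Measurable fun z : 𝒵 => PX {x | acceptsFirst r V k x z} :=
  measurable_measure_prodMk_right (measurableSet_acceptsFirst hr hV k)

/-- The conditional law of the index is compared with the product of the acceptance probability of
proposal `k` and `q ^ k`, where `q = 1 - b⁻¹`. On average this product and the true probability of
index `k` both equal `b⁻¹ * q ^ k`, so the linear terms of the Gibbs inequality cancel after
summation. -/
theorem lintegral_tsum_measure_acceptsFirst_mul_nats_le (hr : Measurable (Function.uncurry r))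
    (hrb : ∀ x y, r x y ≤ b) (hb1 : 1 < b) (hb : b ≠ ∞) (hV : ∀ k, Measurable (V k))
    (hind : iIndepFun V law) (hlam : ∀ k, law.map (V k) = proposalLaw ν b)
    (hW : ∀ x, IsProbabilityMeasure (ν.withDensity (r x))) :
    ∫⁻ z, ∑' k, PX {x | acceptsFirst r V k x z} * nats (PX {x | acceptsFirst r V k x z}) ∂law ≤
      b * ∫⁻ v, PX {x | accepts r x v} * nats (PX {x | accepts r x v}) ∂(proposalLaw ν b) + 1 := by
  have hb0 : b ≠ 0 := (one_pos.trans hb1).ne'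
  have hα := measurable_measure_accepts (PX := PX) hr
  have hπ := measurable_measure_acceptsFirst (PX := PX) hr hV
  have hn := measurable_nats
  have hlap := lintegral_measure_accepts (PX := PX) hr hrb hb0 hb hW
  -- Here `1 < b` must be strict: the comparison weight `q ^ k` has to be nonzero.
  have hq0 : 1 - b⁻¹ ≠ 0 := (tsub_pos_of_lt (ENNReal.inv_lt_one.2 hb1)).ne'
  have hq1 : 1 - b⁻¹ ≤ 1 := tsub_le_self
  have hgeom : ∑' k : ℕ, (1 - b⁻¹) ^ k = b := by
    rw [ENNReal.tsum_geometric, ENNReal.sub_sub_cancel ENNReal.one_ne_top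
      (ENNReal.inv_le_one.2 hb1.le), inv_inv]
  have hgeom' : ∑' k : ℕ, b⁻¹ * (1 - b⁻¹) ^ k = 1 := by
    rw [ENNReal.tsum_mul_left, hgeom, ENNReal.inv_mul_cancel hb0 hb]
  have hI : ∀ {h : 𝒴 × ℝ → ℝ≥0∞} (_ : Measurable h) (k : ℕ),
      ∫⁻ z, PX {x | acceptsFirst r V k x z} * h (V k z) ∂law =
        (∫⁻ v, PX {x | accepts r x v} * h v ∂(proposalLaw ν b)) * (1 - b⁻¹) ^ k := fun hh k =>
    lintegral_measure_acceptsFirst_mul hr hrb hb0 hb hV hind hlam hW hh k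
  have hI1 : ∀ k, ∫⁻ z, PX {x | acceptsFirst r V k x z} ∂law = b⁻¹ * (1 - b⁻¹) ^ k := by
    intro k
    have h := hI (measurable_const (a := (1 : ℝ≥0∞))) k
    simpa only [mul_one, hlap] using h
  have hIa : ∀ k, ∫⁻ z, PX {x | accepts r x (V k z)} ∂law = b⁻¹ := by
    intro k
    rw [← hlap, ← hlam k, lintegral_map hα (hV k)]
  set A := ∫⁻ v, PX {x | accepts r x v} * nats (PX {x | accepts r x v}) ∂(proposalLaw ν b)
  -- The added `1` is the expected total mass of the index probabilities, distributed over `k` to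
  -- supply the linear term of the Gibbs inequality.
  rw [← ENNReal.add_le_add_iff_right ENNReal.one_ne_top]
  calc ∫⁻ z, ∑' k, PX {x | acceptsFirst r V k x z} * nats (PX {x | acceptsFirst r V k x z}) ∂law + 1
      = ∑' k, ∫⁻ z, (PX {x | acceptsFirst r V k x z} * nats (PX {x | acceptsFirst r V k x z}) +
          PX {x | acceptsFirst r V k x z}) ∂law := by
        have hπn : ∀ k, Measurable fun z => PX {x | acceptsFirst r V k x z} *
            nats (PX {x | acceptsFirst r V k x z}) := fun k => (hπ k).mul (hn.comp (hπ k))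
        rw [lintegral_tsum fun k => (hπn k).aemeasurable, ← hgeom',
          ← ENNReal.tsum_add]
        congr 1 with k
        rw [lintegral_add_right _ (hπ k), hI1]
    _ ≤ ∑' k, ∫⁻ z, (PX {x | acceptsFirst r V k x z} * nats (PX {x | accepts r x (V k z)}) +
          PX {x | acceptsFirst r V k x z} * nats ((1 - b⁻¹) ^ k) +
          PX {x | accepts r x (V k z)} * (1 - b⁻¹) ^ k) ∂law := by
        refine ENNReal.tsum_le_tsum fun k => lintegral_mono fun z => ?_
        exact mul_nats_add_le prob_le_one (pow_le_one₀ zero_le hq1) (pow_ne_zero _ hq0)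
          (measure_mono fun x hx => hx.1)
    _ = ∑' k, (A * (1 - b⁻¹) ^ k + b⁻¹ * (1 - b⁻¹) ^ k * nats ((1 - b⁻¹) ^ k) +
          b⁻¹ * (1 - b⁻¹) ^ k) := by
        congr 1 with k
        have hαk : Measurable fun z => PX {x | accepts r x (V k z)} := hα.comp (hV k)
        rw [lintegral_add_right _ (hαk.mul_const _), lintegral_add_right _ ((hπ k).mul_const _),
          lintegral_mul_const _ hαk, lintegral_mul_const _ (hπ k), hIa, hI1]
        congr 2
        exact hI (hn.comp hα) k
    _ ≤ b * A + 1 + 1 := by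
        rw [ENNReal.tsum_add, ENNReal.tsum_add, hgeom', ENNReal.tsum_mul_left, hgeom, mul_comm A]
        gcongr
        exact tsum_inv_mul_geometric_mul_nats_le hb1 hb

variable [StandardBorelSpace 𝒴] [Nonempty 𝒴]

theorem ofReal_log_two_mul_rate_rejectionCode_le {W : Kernel 𝒳 𝒴} [IsMarkovKernel W]
    (hr : Measurable (Function.uncurry r)) (hrb : ∀ x y, r x y ≤ b) (hb1 : 1 < b) (hb : b ≠ ∞)
    (hV : ∀ k, Measurable (V k)) (hind : iIndepFun V law)
    (hlam : ∀ k, law.map (V k) = proposalLaw ν b) (hW : ∀ x, W x = ν.withDensity (r x)) :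
    ENNReal.ofReal (Real.log 2) *
        (rejectionCode W hr hrb hb1.le hb hV hind hlam hW).rate PX ≤
      ∫⁻ y, (∫⁻ l in Set.Ioi (0 : ℝ), PX {x | ENNReal.ofReal l ≤ r x y} *
        nats (PX {x | ENNReal.ofReal l ≤ r x y})) ∂ν + 1 := by
  have hb0 : b ≠ 0 := (one_pos.trans hb1).ne'
  have hW' : ∀ x, IsProbabilityMeasure (ν.withDensity (r x)) := fun x => hW x ▸ inferInstance
  have hrate : (rejectionCode W hr hrb hb1.le hb hV hind hlam hW).rate PX =
      condEntropy (fun p : 𝒳 × 𝒵 => (V (acceptedIndex r V p.1 p.2) p.2).1) Prod.snd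
        (PX.prod law) := by
    simp only [StochasticCode.rate, rejectionCode, List.length_replicate]
  have hsnd : (PX.prod law).map Prod.snd = law := by simp [Measure.map_snd_prod]
  -- For each input acceptance is almost sure; Fubini turns this into a statement for almost every
  -- `z`. The event that the index is `0` by default then carries no `P_X`-mass.
  have hnever : ∀ᵐ z ∂law, PX {x | ∀ j, ¬ accepts r x (V j z)} = 0 := by
    have hm := measurableSet_forall_not_accepts (𝒳 := 𝒳) hr hV
    have h : PX.prod law {p : 𝒳 × 𝒵 | ∀ j, ¬ accepts r p.1 (V j p.2)} = 0 := by
      rw [Measure.measure_prod_null hm]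
      exact Filter.Eventually.of_forall fun x =>
        measure_forall_not_accepts hr hrb hb0 hb hV hind hlam x
    rw [Measure.prod_apply_symm hm, lintegral_eq_zero_iff (measurable_measure_prodMk_right hm)] at h
    exact h
  rw [hrate, condEntropy, hsnd, ← lintegral_const_mul' _ _ ENNReal.ofReal_ne_top]
  calc _ ≤ ∫⁻ z, ∑' k, PX {x | acceptsFirst r V k x z} *
          nats (PX {x | acceptsFirst r V k x z}) ∂law := by
        apply lintegral_mono_ae
        filter_upwards [hnever, condDistrib_snd_prod_ae_eq PX law (measurable_accepted hr hV)]
          with z hz hz'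
        rw [hz']
        have hK : Measurable fun x => acceptedIndex r V x z :=
          (measurable_acceptedIndex hr hV).comp measurable_prodMk_right
        refine (ofReal_log_two_mul_entropy_map_le PX hK fun k => (V k z).1).trans (le_of_eq ?_)
        congr 1 with k
        have : PX {x | acceptedIndex r V x z = k} = PX {x | acceptsFirst r V k x z} := by
          refine le_antisymm ?_ (measure_mono fun x hx => acceptedIndex_eq_iff.2 (Or.inl hx))
          calc _ ≤ PX ({x | acceptsFirst r V k x z} ∪ {x | ∀ j, ¬ accepts r x (V j z)}) :=
                measure_mono fun x hx => (acceptedIndex_eq_iff.1 hx).imp_right And.right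
            _ ≤ _ := (measure_union_le _ _).trans (by rw [hz, add_zero])
        rw [this]
    _ ≤ b * ∫⁻ v, PX {x | accepts r x v} * nats (PX {x | accepts r x v}) ∂(proposalLaw ν b) + 1 :=
        lintegral_tsum_measure_acceptsFirst_mul_nats_le hr hrb hb1 hb hV hind hlam hW'
    _ ≤ _ := by
        have hα := measurable_measure_accepts (PX := PX) hr
        gcongr
        refine (mul_le_mul_right (lintegral_proposalLaw_le
          (hα.mul (measurable_nats.comp hα)) hb0 hb) b).trans (le_of_eq ?_)
        rw [← mul_assoc, ENNReal.mul_inv_cancel hb0 hb, one_mul]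
        rfl

end Rate

/-! ### Construction of the common randomness and conclusion -/

theorem standardBorelSpace_ulift_nat_real : StandardBorelSpace (ULift.{w} (ℕ → ℝ)) := by
  have : PolishSpace (ULift.{w} (ℕ → ℝ)) := Homeomorph.ulift.isClosedEmbedding.polishSpace
  infer_instance

/-- Every law on a standard Borel space is the common law of a sequence of independent random
variables on a standard Borel space in any given universe. -/
theorem exists_iIndepFun_standardBorel {E : Type v} [MeasurableSpace E] [StandardBorelSpace E]
    (lam : Measure E) [IsProbabilityMeasure lam] :
    ∃ (𝒵 : Type w) (_ : MeasurableSpace 𝒵) (_ : StandardBorelSpace 𝒵) (law : Measure 𝒵)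
      (_ : IsProbabilityMeasure law) (V : ℕ → 𝒵 → E),
      (∀ k, Measurable (V k)) ∧ iIndepFun V law ∧ ∀ k, law.map (V k) = lam := by
  have : Nonempty E := nonempty_of_isProbabilityMeasure lam
  -- Coding `E` in `ℝ` detaches the sample space from the universe of `E`; `ULift` then moves real
  -- sequences to the required universe.
  have he := measurableEmbedding_embeddingReal E
  have hinv := he.measurable_invFun
  have hP := Measure.isProbabilityMeasure_map (μ := lam) he.measurable.aemeasurable
  have hup : Measurable (ULift.up.{w} : (ℕ → ℝ) → ULift (ℕ → ℝ)) := measurable_up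
  have hV : ∀ k : ℕ, Measurable fun z : ULift.{w} (ℕ → ℝ) => he.invFun (z.down k) := fun k =>
    hinv.comp ((measurable_pi_apply k).comp measurable_down)
  refine ⟨ULift.{w} (ℕ → ℝ), inferInstance, standardBorelSpace_ulift_nat_real,
    (Measure.infinitePi fun _ : ℕ => lam.map (embeddingReal E)).map ULift.up,
    Measure.isProbabilityMeasure_map hup.aemeasurable, fun k z => he.invFun (z.down k), hV, ?_, ?_⟩
  · have h := iIndepFun_infinitePi (P := fun _ : ℕ => lam.map (embeddingReal E))
      (X := fun _ => he.invFun) fun _ => hinv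
    rw [iIndepFun_iff_map_fun_eq_infinitePi_map hV, Measure.map_map (measurable_pi_lambda _ hV) hup]
    have hVk : ∀ k : ℕ, Measurable fun f : ℕ → ℝ => he.invFun (f k) := fun k =>
      hinv.comp (measurable_pi_apply k)
    rw [iIndepFun_iff_map_fun_eq_infinitePi_map hVk] at h
    refine Eq.trans h ?_
    congr 1 with k : 1
    rw [Measure.map_map (hV k) hup]
    rfl
  · intro k
    rw [Measure.map_map (hV k) hup]
    change (Measure.infinitePi _).map (he.invFun ∘ fun z : ℕ → ℝ => z k) = lam
    rw [← Measure.map_map hinv (measurable_pi_apply k), Measure.infinitePi_map_eval,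
      Measure.map_map hinv he.measurable, he.leftInverse_invFun.comp_eq_id, Measure.map_id]

theorem mainTheorem2 {𝒳 : Type u} {𝒴 : Type v}
    [MeasurableSpace 𝒳] [StandardBorelSpace 𝒳] [Nonempty 𝒳]
    [MeasurableSpace 𝒴] [StandardBorelSpace 𝒴] [Nonempty 𝒴]
    (P : Measure (𝒳 × 𝒴)) [IsProbabilityMeasure P]
    (W : Kernel 𝒳 𝒴) [IsMarkovKernel W] (hW : P.fst.compProd W = P)
    (M : ℝ≥0)
    (hM : ∀ x, W x ≪ P.snd ∧ ∀ᵐ y ∂P.snd, (W x).rnDeriv P.snd y ≤ (M : ℝ≥0∞)) :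
    functionalInformation P ≤ minRate.{u, v, w} P ∧
      minRate.{u, v, w} P ≤ minCodeRate.{u, v, w} P.fst W ∧
      minCodeRate.{u, v, w} P.fst W ≤
        functionalInformation P + ENNReal.ofReal (Real.logb 2 (Real.exp 1)) := by
  -- The height `b = M + 2` dominates the density, is finite, and exceeds `1` strictly, so that
  -- rejection has positive probability.
  have hb : (M + 2 : ℝ≥0∞) ≠ ∞ := by simp
  have hb1 : (1 : ℝ≥0∞) < M + 2 := ENNReal.one_lt_two.trans_le le_add_self
  obtain ⟨r, hr, hrb, hWr⟩ := exists_bounded_density W P.snd (M + 2 : ℝ≥0∞) fun x =>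
    ⟨(hM x).1, (hM x).2.mono fun y hy => hy.trans le_self_add⟩
  have hP : P = (P.fst.prod P.snd).withDensity (Function.uncurry r) := by
    rw [← compProd_eq_prod_withDensity hr hrb hb hWr, hW]
  refine ⟨le_sInf ?_, le_sInf ?_, ?_⟩
  · rintro _ ⟨𝒵, _, _, μ, _, hμ, rfl⟩
    exact hμ.functionalInformation_le hr hrb hb hP
  · rintro _ ⟨𝒵, i1, i2, C, rfl⟩
    obtain ⟨μ, hμ, hC, hrate⟩ := C.exists_isCommonRandomness P.fst
    rw [hW] at hC
    exact sInf_le ⟨𝒵, i1, i2, μ, hμ, hC, hrate⟩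
  · have := isProbabilityMeasure_proposalLaw (ν := P.snd) (one_pos.trans hb1).ne' hb
    obtain ⟨𝒵, i1, i2, law, _, V, hV, hind, hlam⟩ :=
      exists_iIndepFun_standardBorel.{v, w} (proposalLaw P.snd (M + 2 : ℝ≥0∞))
    have hle : minCodeRate.{u, v, w} P.fst W ≤
        (rejectionCode W hr hrb hb1.le hb hV hind hlam hWr).rate P.fst :=
      sInf_le ⟨𝒵, i1, i2, _, rfl⟩
    refine hle.trans ?_
    have h2 : 0 < Real.log 2 := Real.log_pos one_lt_two
    rw [← ENNReal.mul_le_mul_iff_right (a := ENNReal.ofReal (Real.log 2)) (by simpa using h2)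
      ENNReal.ofReal_ne_top, mul_add, ofReal_log_two_mul_functionalInformation hr hrb hb hP,
      ← ENNReal.ofReal_mul h2.le, Real.logb, Real.log_exp, mul_one_div_cancel h2.ne',
      ENNReal.ofReal_one]
    exact ofReal_log_two_mul_rate_rejectionCode_le hr hrb hb1 hb hV hind hlam hWr
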